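/- Work over $\mathbb{C}$. Let $S$ and $\widetilde S$ be smooth projective (irreducible) surfaces, let $\mathcal{F}$ be a foliation on $S$, i.e. a saturated invertible subsheaf $T_{\mathcal{F}}\subseteq T_S$ of the tangent sheaf, and let $K_{\mathcal{F}}=T_{\mathcal{F}}^{*}$ be its canonical divisor (defined up to linear equivalence). Let $\Pi:\widetilde S\to S$ be a generically finite (dominant) morphism over $\mathbb{C}$, and let $\widetilde{\mathcal{F}}=\Pi^*\mathcal{F}$ be the induced foliation: if $\mathcal{F}$ is defined by local one-forms $\omega_i$, then $\widetilde{\mathcal{F}}$ is the foliation defined by the one-forms $\Pi^*\omega_i$ divided by their divisorial zeros. (i) The canonical divisor of $\widetilde{\mathcal{F}}$ can be expressed, up to linear equivalence, as $$K_{\widetilde{\mathcal{F}}}=\Pi^*(K_{\mathcal{F}})+\sum (t_i-1)R_i+\mathcal{E},$$ where the sum is taken over all irreducible curves $R_i$ on $\widetilde S$, not contracted by $\Pi$, along which $\Pi$ is ramified and which are not $\widetilde{\mathcal{F}}$-invariant, $t_i$ is the ramification index of $\Pi$ along $R_i$, and $\mathcal{E}$ is a divisor supported on curves contracted by $\Pi$.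 (ii) If moreover $\mathcal{F}$ is reduced, then the divisor $\mathcal{E}$ in (i) is effective. Here $\mathcal{F}$ is reduced if at each of its singular points, where it is defined by a local vector field $v$ with isolated zeros, the two eigenvalues $\lambda_1,\lambda_2$ of the linear part of $v$ can be ordered such that $\lambda_2\neq 0$ and $\lambda_1/\lambda_2$ is not a positive rational number. -/

import Mathlib

open AlgebraicGeometry CategoryTheory

noncomputable section

attribute [local instance] MvPolynomial.gradedAlgebra

/-! ### Smooth projective surfaces over the complex numbers -/

/-- Projective `n`-space over `ℂ`. -/
def complexProjectiveSpace (n : ℕ) : Scheme.{0} :=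
  Proj (MvPolynomial.homogeneousSubmodule (Fin (n + 1)) ℂ)

/-- The structure morphism of projective `n`-space over `ℂ`. -/
def complexProjectiveSpace.toSpec (n : ℕ) :
    complexProjectiveSpace n ⟶ Spec (CommRingCat.of ℂ) :=
  Proj.toSpecZero (MvPolynomial.homogeneousSubmodule (Fin (n + 1)) ℂ) ≫
    Spec.map (CommRingCat.ofHom
      (algebraMap ℂ (MvPolynomial.homogeneousSubmodule (Fin (n + 1)) ℂ 0)))

/-- A smooth projective surface over `ℂ`: an integral scheme over `ℂ`, smooth of relative
dimension two, that is a closed subscheme of some projective space over `ℂ`. -/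
structure SmoothProjectiveSurface where
  /-- the underlying scheme -/
  X : Scheme.{0}
  /-- the structure morphism -/
  str : X ⟶ Spec (CommRingCat.of ℂ)
  isIntegral : IsIntegral X
  smooth : SmoothOfRelativeDimension 2 str
  projective : ∃ (n : ℕ) (i : X ⟶ complexProjectiveSpace n),
    IsClosedImmersion i ∧ i ≫ complexProjectiveSpace.toSpec n = str

attribute [instance] SmoothProjectiveSurface.isIntegral SmoothProjectiveSurface.smooth

instance (S : SmoothProjectiveSurface) : IsLocallyNoetherian S.X := by
  have : Smooth S.str := SmoothOfRelativeDimension.smooth 2 S.str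
  exact LocallyOfFiniteType.isLocallyNoetherian S.str

/-! ### Divisors on integral schemes -/

section Divisors

variable (X : Scheme.{0}) [IsIntegral X]

/-- The units of the local ring at `x`, as a subgroup of the units of the function field. -/
def localUnits (x : X) : Subgroup (X.functionField)ˣ :=
  (Units.map (algebraMap (X.presheaf.stalk x) X.functionField).toMonoidHom).range

/-- A Cartier divisor on an integral scheme: a global section of the sheaf `𝒦ˣ / 𝒪ˣ`, given by its
germs (the classes of the local equations). -/
@[ext]
structure CartierDivisor where
  /-- the class of the local equations at `x` -/
  germ : (x : X) → (X.functionField)ˣ ⧸ localUnits X x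
  locallyPrincipal : ∀ x : X, ∃ U : X.Opens, x ∈ U ∧
    ∃ f : (X.functionField)ˣ, ∀ y ∈ U, germ y = QuotientGroup.mk f

/-- The principal Cartier divisor of a nonzero rational function. -/
def CartierDivisor.principal (f : (X.functionField)ˣ) : CartierDivisor X where
  germ _ := QuotientGroup.mk f
  locallyPrincipal _ := ⟨⊤, trivial, f, fun _ _ => rfl⟩

variable [IsLocallyNoetherian X]

/-- The group of Weil divisors: algebraic cycles all of whose components have codimension one.
A prime divisor is represented by its generic point. -/
def WeilDivisor : AddSubgroup (AlgebraicCycle X ℤ) where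
  carrier := {D | ∀ x, D x ≠ 0 → Order.coheight x = 1}
  zero_mem' := by intro x hx; exact absurd rfl hx
  add_mem' := by
    intro a b ha hb x hx
    by_cases h : a x = 0
    · refine hb x fun h' => hx ?_
      simp [h, h']
    · exact ha x h
  neg_mem' := by
    intro a ha x hx
    refine ha x fun h => hx ?_
    simp [h]

variable {X}

/-- The order of vanishing at `x`, as a homomorphism on nonzero rational functions. -/
def ordAt (x : X) : (X.functionField)ˣ →* Multiplicative ℤ where
  toFun f := Multiplicative.ofAdd (Scheme.ord (f : X.functionField) x)
  map_one' := by
    have h := Scheme.ord_mul (x := x) (one_ne_zero (α := X.functionField))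
      (one_ne_zero (α := X.functionField))
    rw [mul_one] at h
    have h0 : Scheme.ord (1 : X.functionField) x = 0 := by omega
    simp [h0]
  map_mul' f g := by
    simp [Scheme.ord_mul f.ne_zero g.ne_zero, ofAdd_add]

lemma localUnits_le_ker_ordAt (x : X) : localUnits X x ≤ (ordAt x).ker := by
  rintro _ ⟨u, rfl⟩
  rw [MonoidHom.mem_ker]
  by_cases hx : Order.coheight x = 1
  · have : Ring.KrullDimLE 1 (X.presheaf.stalk x) := krullDimLE_of_coheight_le hx.le
    have h1 : Scheme.ordHom x hx (algebraMap (X.presheaf.stalk x) X.functionField u) = 1 :=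
      Ring.ordFrac_of_isUnit u.isUnit
    have h0 : Scheme.ord (algebraMap (X.presheaf.stalk x) X.functionField u) x = 0 := by
      rw [Scheme.ord_eq_iff hx (u.isUnit.map _).ne_zero, h1]
      rfl
    exact congrArg Multiplicative.ofAdd h0
  · exact congrArg Multiplicative.ofAdd (Scheme.ord_eq_zero_of_coheight_neq_one hx _)

/-- The multiplicity of a Cartier divisor along the prime divisor with generic point `x`: the order
of vanishing at `x` of a local equation (and `0` if `x` does not have codimension one). -/
def CartierDivisor.mult (D : CartierDivisor X) (x : X) : ℤ :=
  (QuotientGroup.lift (localUnits X x) (ordAt x) (localUnits_le_ker_ordAt x) (D.germ x)).toAdd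

lemma CartierDivisor.mult_eq (D : CartierDivisor X) (x : X) (f : (X.functionField)ˣ)
    (h : D.germ x = QuotientGroup.mk f) : D.mult x = Scheme.ord (f : X.functionField) x := by
  simp only [mult, h, QuotientGroup.lift_mk]
  rfl

/-- A nonzero rational function has only finitely many zeros and poles on an affine open set. -/
lemma finite_ord_ne_zero (f : (X.functionField)ˣ) (V : X.Opens) (hV : IsAffineOpen V) :
    {x | x ∈ V ∧ Scheme.ord (f : X.functionField) x ≠ 0}.Finite := by
  obtain ⟨U, -, f', hU, hf, hu⟩ := exists_isUnit_germ_eq X (f : X.functionField) f.ne_zero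
  have hgen : genericPoint X ∈ U :=
    ((genericPoint_spec X).mem_open_set_iff U.isOpen).mpr (by simpa using hU)
  have : IsNoetherianRing Γ(X, V) := IsLocallyNoetherian.component_noetherian ⟨V, hV⟩
  have : TopologicalSpace.NoetherianSpace (V : Set X) := noetherianSpace_of_isAffineOpen V hV
  obtain ⟨S, hSf, -, hS, hZ⟩ :=
    TopologicalSpace.NoetherianSpace.exists_finite_set_isClosed_irreducible (α := (V : Set X))
      (U.isOpen.isClosed_compl.preimage (continuous_subtype_val (p := (· ∈ (V : Set X)))))
  have hirr : ∀ T ∈ S, ∃ t : X, IsGenericPoint t (closure (Subtype.val '' T)) :=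
    fun T hT => QuasiSober.sober ((hS T hT).image _ continuous_subtype_val.continuousOn).closure
      isClosed_closure
  choose! t ht using hirr
  refine (hSf.image t).subset ?_
  rintro x ⟨hxV, hx⟩
  have hxc : Order.coheight x = 1 := by
    by_contra h
    exact hx (Scheme.ord_eq_zero_of_coheight_neq_one h _)
  have hxU : x ∉ U := fun h => hx (by rw [← hf]; exact Scheme.ord_of_isUnit hu h)
  have hxZ : (⟨x, hxV⟩ : (V : Set X)) ∈ ⋃₀ S := by rw [← hZ]; exact hxU
  obtain ⟨T, hT, hxT⟩ := hxZ
  have htx : t T ⤳ x := by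
    rw [specializes_iff_mem_closure, (ht T hT).def]
    exact subset_closure ⟨_, hxT, rfl⟩
  have htU : t T ∉ U := by
    have h1 : closure (Subtype.val '' T) ⊆ (U : Set X)ᶜ := by
      refine closure_minimal ?_ U.isOpen.isClosed_compl
      rintro _ ⟨y, hy, rfl⟩
      have : y ∈ ⋃₀ S := ⟨T, hT, hy⟩
      rw [← hZ] at this
      exact this
    exact h1 ((ht T hT).mem)
  refine ⟨T, hT, ?_⟩
  by_contra hne
  have h1 : x < t T := ⟨htx, fun h => hne (htx.antisymm h).eq⟩
  have h2 : t T < genericPoint X := ⟨(genericPoint_spec X).specializes trivial,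
    fun h => htU (h.mem_open U.isOpen hgen)⟩
  have h3 := Order.coheight_add_one_le h1
  have h4 := Order.coheight_add_one_le h2
  have h5 : (1 : ℕ∞) + 1 ≤ 1 :=
    calc (1 : ℕ∞) + 1 ≤ (Order.coheight (genericPoint X) + 1) + 1 := by gcongr; exact le_add_self
      _ ≤ Order.coheight (t T) + 1 := by gcongr
      _ ≤ 1 := h3.trans hxc.le
  exact absurd h5 (by decide)

/-- The Weil divisor associated with a Cartier divisor. -/
def CartierDivisor.toWeil (D : CartierDivisor X) : WeilDivisor X :=
  ⟨{ toFun := D.mult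
     supportWithinDomain' := Set.subset_univ _
     supportLocallyFiniteWithinDomain' := by
      intro x _
      obtain ⟨U, hxU, f, hf⟩ := D.locallyPrincipal x
      obtain ⟨_, ⟨V, hV, rfl⟩, hxV, hVU⟩ :=
        X.isBasis_affineOpens.exists_subset_of_mem_open hxU U.isOpen
      refine ⟨V, V.isOpen.mem_nhds hxV, (finite_ord_ne_zero f V hV).subset ?_⟩
      rintro y ⟨hy, hy'⟩
      exact ⟨hy, by rwa [← D.mult_eq y f (hf y (hVU hy))]⟩ },
    by
      intro x hx
      by_contra h
      obtain ⟨f, hf⟩ := QuotientGroup.mk_surjective (D.germ x)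
      refine hx ((D.mult_eq x f hf.symm).trans (Scheme.ord_eq_zero_of_coheight_neq_one h _))⟩

/-- Linear equivalence of Weil divisors: they differ by the divisor of a rational function. -/
def WeilDivisor.LinEquiv (D D' : WeilDivisor X) : Prop :=
  ∃ f : (X.functionField)ˣ, D - D' = (CartierDivisor.principal X f).toWeil

end Divisors

/-! ### Dominant morphisms -/

section Dominant

variable {X Y : Scheme.{0}} [IsIntegral X] [IsIntegral Y] (p : X ⟶ Y) [IsDominant p]

lemma specializes_of_isDominant : p (genericPoint X) ⤳ genericPoint Y := by
  have h : IsGenericPoint (p (genericPoint X)) (closure (p '' Set.univ)) :=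
    (genericPoint_spec X).image p.continuous
  have h2 : closure (p '' Set.univ) = Set.univ := by
    rw [Set.image_univ]
    exact p.denseRange.closure_range
  rw [h2] at h
  exact h.specializes trivial

/-- The pull-back of rational functions under a dominant morphism. -/
def functionFieldMap : Y.functionField →+* X.functionField :=
  (Y.presheaf.stalkSpecializes (specializes_of_isDominant p) ≫ p.stalkMap (genericPoint X)).hom

lemma functionFieldMap_algebraMap (x : X) (a : Y.presheaf.stalk (p x)) :
    functionFieldMap p (algebraMap (Y.presheaf.stalk (p x)) Y.functionField a) =
      algebraMap (X.presheaf.stalk x) X.functionField (p.stalkMap x a) := by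
  have h := Scheme.Hom.stalkSpecializes_stalkMap p (genericPoint X) x
    ((genericPoint_spec X).specializes trivial)
  have h2 : algebraMap (Y.presheaf.stalk (p x)) Y.functionField =
      (Y.presheaf.stalkSpecializes ((genericPoint_spec Y).specializes trivial)).hom := rfl
  have h3 : algebraMap (X.presheaf.stalk x) X.functionField =
      (X.presheaf.stalkSpecializes ((genericPoint_spec X).specializes trivial)).hom := rfl
  rw [h2, h3, functionFieldMap, ← CommRingCat.comp_apply, ← CommRingCat.comp_apply, ← h,
    TopCat.Presheaf.stalkSpecializes_comp_assoc]

/-- Pull-back of Cartier divisors under a dominant morphism: local equations are pulled back. -/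
def CartierDivisor.pullback (D : CartierDivisor Y) : CartierDivisor X where
  germ x := QuotientGroup.map (localUnits Y (p x)) (localUnits X x)
    (Units.map (functionFieldMap p).toMonoidHom)
    (by
      rintro _ ⟨u, rfl⟩
      refine ⟨Units.map (p.stalkMap x).hom.toMonoidHom u, Units.ext ?_⟩
      exact (functionFieldMap_algebraMap p x u).symm)
    (D.germ (p x))
  locallyPrincipal x := by
    obtain ⟨U, hxU, f, hf⟩ := D.locallyPrincipal (p x)
    exact ⟨p ⁻¹ᵁ U, hxU, Units.map (functionFieldMap p).toMonoidHom f, fun y hy => by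
      rw [hf (p y) hy]; rfl⟩

end Dominant

/-- A generically finite morphism of integral schemes: it is dominant, and finite over some
nonempty open subset of the target. -/
class IsGenericallyFinite {X Y : Scheme.{0}} (p : X ⟶ Y) : Prop extends IsDominant p where
  finite : ∃ V : Y.Opens, (V : Set Y).Nonempty ∧ IsFinite (p ∣_ V)

/-- A curve, given by its generic point `x`, is contracted if its image is a point. -/
def IsContracted {X Y : Scheme.{0}} (p : X ⟶ Y) (x : X) : Prop :=
  (p '' closure {x}).Subsingleton

/-- The ramification index at `x` of a morphism of schemes: the largest `n` such that the maximal
ideal of the local ring at `p x` is mapped into the `n`-th power of the maximal ideal at `x`. -/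
def ramificationIndex {X Y : Scheme.{0}} (p : X ⟶ Y) (x : X) : ℕ :=
  sSup {n : ℕ | (IsLocalRing.maximalIdeal (Y.presheaf.stalk (p x))).map (p.stalkMap x).hom ≤
    IsLocalRing.maximalIdeal (X.presheaf.stalk x) ^ n}

/-! ### Vector fields and foliations -/

namespace SmoothProjectiveSurface

variable (S : SmoothProjectiveSurface)

/-- The field of rational functions. -/
abbrev K : Type := S.X.functionField

/-- The local ring at a point. -/
abbrev O (x : S.X) : Type := S.X.presheaf.stalk x

/-- The inclusion of the constants in the local ring at `x`. -/
def const (x : S.X) : ℂ →+* S.O x :=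
  ((Scheme.ΓSpecIso (CommRingCat.of ℂ)).inv ≫ S.str.appTop ≫
    S.X.presheaf.germ ⊤ x trivial).hom

instance : Algebra ℂ S.K := (S.const (genericPoint S.X)).toAlgebra

instance (x : S.X) : SMulCommClass ℂ (S.O x) S.K where
  smul_comm c a b := by simp only [Algebra.smul_def]; ring

/-- Rational vector fields: the `ℂ`-linear derivations of the function field. -/
abbrev RatVectorField : Type := Derivation ℂ S.K S.K

/-- The stalk at `x` of the tangent sheaf: the rational vector fields that are regular at `x`,
i.e. that preserve the local ring at `x`. -/
def tangent (x : S.X) : Submodule (S.O x) S.RatVectorField where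
  carrier := {v | ∀ a : S.O x, ∃ b : S.O x, v (algebraMap _ S.K a) = algebraMap _ S.K b}
  zero_mem' := fun a => ⟨0, by simp⟩
  add_mem' := by
    intro v w hv hw a
    obtain ⟨b, hb⟩ := hv a
    obtain ⟨c, hc⟩ := hw a
    exact ⟨b + c, by simp [hb, hc]⟩
  smul_mem' := by
    intro f v hv a
    obtain ⟨b, hb⟩ := hv a
    exact ⟨f * b, by simp [hb, Algebra.smul_def]⟩

end SmoothProjectiveSurface

/-- A foliation on a smooth projective surface: a saturated invertible subsheaf of the tangent
sheaf, given by its stalks. -/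
structure Foliation (S : SmoothProjectiveSurface) where
  /-- the stalks of the tangent sheaf of the foliation -/
  T : (x : S.X) → Submodule (S.O x) S.RatVectorField
  le_tangent : ∀ x, T x ≤ S.tangent x
  invertible : ∀ x, ∃ U : S.X.Opens, x ∈ U ∧ ∃ v : S.RatVectorField, v ≠ 0 ∧
    ∀ y ∈ U, T y = Submodule.span (S.O y) {v}
  saturated : ∀ x, ∀ v ∈ S.tangent x, ∀ a : S.O x, a ≠ 0 → a • v ∈ T x → v ∈ T x

namespace Foliation

variable {S : SmoothProjectiveSurface} (F : Foliation S)

/-- `D` is a canonical divisor of the foliation: multiplication by a rational vector field `v`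
is an isomorphism from `𝒪(-D)` to the tangent sheaf of the foliation. -/
def IsCanonicalDivisor (D : CartierDivisor S.X) : Prop :=
  ∃ v : S.RatVectorField, ∀ (x : S.X) (f : (S.K)ˣ), D.germ x = QuotientGroup.mk f →
    F.T x = Submodule.span (S.O x) {(f : S.K) • v}

lemma smul_eq_algebraMap_smul (x : S.X) (a : S.O x) (v : S.RatVectorField) :
    a • v = (algebraMap (S.O x) S.K a) • v := by
  ext b
  simp [Algebra.smul_def]

lemma exists_unit_of_span_eq (x : S.X) {v w : S.RatVectorField} (hv : v ≠ 0)
    (h : Submodule.span (S.O x) {v} = Submodule.span (S.O x) {w}) :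
    ∃ u ∈ localUnits S.X x, v = (u : S.K) • w := by
  obtain ⟨a, ha⟩ := Submodule.mem_span_singleton.mp
    (h ▸ Submodule.mem_span_singleton_self v : v ∈ Submodule.span (S.O x) {w})
  obtain ⟨b, hb⟩ := Submodule.mem_span_singleton.mp
    (h ▸ Submodule.mem_span_singleton_self w : w ∈ Submodule.span (S.O x) {v})
  rw [smul_eq_algebraMap_smul] at ha hb
  have hab : algebraMap (S.O x) S.K (a * b) = 1 := by
    have h1 : (algebraMap (S.O x) S.K (a * b)) • v = (1 : S.K) • v := by
      rw [map_mul, mul_smul, hb, ha, one_smul]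
    exact smul_left_injective S.K hv h1
  have hab' : a * b = 1 := IsFractionRing.injective (S.O x) S.K (by rw [hab, map_one])
  exact ⟨_, ⟨⟨a, b, hab', by rw [mul_comm, hab']⟩, rfl⟩, ha.symm⟩

lemma span_unit_smul (x : S.X) {u : (S.K)ˣ} (hu : u ∈ localUnits S.X x) (w : S.RatVectorField) :
    Submodule.span (S.O x) {(u : S.K) • w} = Submodule.span (S.O x) {w} := by
  obtain ⟨a, rfl⟩ := hu
  have h : ((Units.map (algebraMap (S.O x) S.K).toMonoidHom a : (S.K)ˣ) : S.K) • w =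
      (a : S.O x) • w := (smul_eq_algebraMap_smul x (a : S.O x) w).symm
  erw [h]
  exact Submodule.span_singleton_smul_eq a.isUnit w

/-- Every foliation has a canonical divisor. -/
lemma exists_isCanonicalDivisor : ∃ D : CartierDivisor S.X, F.IsCanonicalDivisor D := by
  choose U hxU v hv hT using F.invertible
  have hgen : ∀ x, genericPoint S.X ∈ U x := fun x =>
    ((genericPoint_spec S.X).mem_open_set_iff (U x).isOpen).mpr ⟨x, trivial, hxU x⟩
  let w := v (genericPoint S.X)
  have hf : ∀ x, ∃ f : (S.K)ˣ, v x = (f : S.K) • w := fun x => by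
    obtain ⟨u, -, hu⟩ := exists_unit_of_span_eq (genericPoint S.X) (hv x)
      ((hT x _ (hgen x)).symm.trans (hT _ _ (hgen _)))
    exact ⟨u, hu⟩
  choose f hf using hf
  refine ⟨⟨fun x => QuotientGroup.mk (f x), fun x => ⟨U x, hxU x, f x, fun y hy => ?_⟩⟩, w, ?_⟩
  · obtain ⟨u, hu, h⟩ := exists_unit_of_span_eq y (hv x) ((hT x y hy).symm.trans (hT y y (hxU y)))
    have h1 : f x = u * f y := by
      have h2 : ((f x : (S.K)ˣ) : S.K) • w = ((u * f y : (S.K)ˣ) : S.K) • w := by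
        rw [← hf x, h, hf y, Units.val_mul, mul_smul]
      exact Units.ext (smul_left_injective S.K (hv _) h2)
    rw [QuotientGroup.eq, h1]
    simpa [mul_comm u] using hu
  · intro x g hg
    have hu := QuotientGroup.eq.mp hg
    rw [hT x x (hxU x), hf x, ← span_unit_smul x hu, ← mul_smul, ← Units.val_mul, mul_comm,
      mul_inv_cancel_left]

/-- The singular points: those where the vector fields defining the foliation vanish. -/
def IsSingularPoint (x : S.X) : Prop :=
  ∀ v ∈ F.T x, ∀ a : S.O x, ∃ b ∈ IsLocalRing.maximalIdeal (S.O x),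
    v (algebraMap _ S.K a) = algebraMap _ S.K b

/-- A reduced singularity: for a local generator `v` of the foliation and local coordinates `z 0`,
`z 1`, the two eigenvalues `l`, `m` of the linear part `A` of `v` satisfy `m ≠ 0`, and `l / m` is
not a positive rational number. -/
def IsReducedSingularity (x : S.X) : Prop :=
  F.IsSingularPoint x ∧
  ∃ v : S.RatVectorField, F.T x = Submodule.span (S.O x) {v} ∧
  ∃ z : Fin 2 → S.O x, IsLocalRing.maximalIdeal (S.O x) = Ideal.span (Set.range z) ∧
  ∃ A : Matrix (Fin 2) (Fin 2) ℂ,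
    (∀ i, ∃ e ∈ IsLocalRing.maximalIdeal (S.O x) ^ 2,
      v (algebraMap _ S.K (z i)) = algebraMap _ S.K (∑ j, S.const x (A i j) * z j + e)) ∧
  ∃ l m : ℂ, A.charpoly = (Polynomial.X - Polynomial.C l) * (Polynomial.X - Polynomial.C m) ∧
    m ≠ 0 ∧ ∀ r : ℚ, 0 < r → l / m ≠ (r : ℂ)

/-- A foliation is reduced if all its singularities are. -/
def IsReduced : Prop :=
  ∀ x, F.IsSingularPoint x → F.IsReducedSingularity x

/-- A curve, given by its generic point `x`, is invariant if the vector fields defining the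
foliation preserve the ideal of the curve (i.e. are tangent to it) at all points of the curve. -/
def IsInvariant (x : S.X) : Prop :=
  ∀ (q : S.X) (h : x ⤳ q), ∀ v ∈ F.T q,
    ∀ a ∈ (IsLocalRing.maximalIdeal (S.O x)).comap (S.X.presheaf.stalkSpecializes h).hom,
    ∃ b ∈ (IsLocalRing.maximalIdeal (S.O x)).comap (S.X.presheaf.stalkSpecializes h).hom,
      v (algebraMap _ S.K a) = algebraMap _ S.K b

/-- `F'` is the pull-back of `F`: it is the foliation defined by the pull-backs of the one-forms
defining `F`. Explicitly, for each rational one-form `∑ aᵢ dbᵢ` that vanishes on the vector fields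
defining `F`, form the pull-back `∑ p^*aᵢ d(p^*bᵢ)`; the tangent sheaf of `F'` consists of the
vector fields that are annihilated by all these pull-backs. -/
def IsPullback {S' : SmoothProjectiveSurface} (p : S'.X ⟶ S.X) [IsDominant p]
    (F' : Foliation S') : Prop :=
  ∀ (x : S'.X) (w : S'.RatVectorField), w ∈ F'.T x ↔ w ∈ S'.tangent x ∧
    ∀ (n : ℕ) (a b : Fin n → S.K),
      (∀ (y : S.X), ∀ v ∈ F.T y, ∑ i, a i * v (b i) = 0) →
      ∑ i, functionFieldMap p (a i) * w (functionFieldMap p (b i)) = 0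

open Classical in
/-- The multiplicity of the prime divisor with generic point `x` in the sum `∑ (tᵢ - 1) Rᵢ` over all
ramification curves `Rᵢ` that are not invariant under the foliation `F`; here the ramification index
`tᵢ` of a curve that is not contracted is the ramification index at its generic point. -/
def ramificationMult {Y : Scheme.{0}} (p : S.X ⟶ Y) (x : S.X) : ℤ :=
  if Order.coheight x = 1 ∧ ¬ IsContracted p x ∧ ¬ F.IsInvariant x then
    (ramificationIndex p x : ℤ) - 1
  else 0

end Foliation

end

/-!
Locally on both surfaces, the foliations are generated by vector fields `v` and `w`, and the
definition of the pull-back by one-forms says that `w` and `v` are proportional: there is a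
rational function `h` with `w (p^* b) = h * p^* (v b)` for all rational functions `b` on the
target (`Foliation.IsPullback.exists_relation`). The orders of the functions `h` along the curves
of the source define a divisor, the discrepancy, which does not depend on the generators and which
is linearly equivalent to the difference of the canonical divisor of the pull-back foliation and
the pull-back of the canonical divisor (`exists_toWeil_sub_apply_eq_ord`). So `R` and `E` are the
parts of the discrepancy on the curves that are not contracted and on those that are contracted,
and it remains to compute `ord h` along a single curve.

Along a curve that is not contracted (`ord_eq_ramificationMult`), the homomorphism of local rings
is an extension of discrete valuation rings of residue characteristic zero, with uniformizers `t`
and `s = unit * t ^ e`, and neither `v` nor `w` vanishes along the curve, as the tangent sheaves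
are saturated. If `w` is transversal to the curve, then `w (p^* s)` has order `e - 1`, and the
relation between `w` and `v` forces `ord h = e - 1`. If the curve is invariant, then `w` induces a
nonzero derivation of the residue field; the residue field extension is algebraic and separable,
so this derivation is nonzero on the smaller field, and `ord h = 0`. Both cases are
`Derivation.multiple_of_ramified`.

Along a contracted curve with `ord h < 0`, the vector field `v` pulls back to `t • D` for a vector
field `D` that is regular along the curve (`ord_nonneg_of_isReduced`). In particular `v` vanishes
at the image point, so there is a reduced singularity. But `v` acts on the elements of order
exactly `n` along the curve, to leading order, as multiplication by `n * D t`
(`Derivation.pow_succ_dvd_sub`). One chooses coordinates `z₁`, `z₂` of orders `a ≤ b` with `b` as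
large as possible; this is possible since the valuation is divisorial, its residue field being
transcendental over the constants (`exists_bound_of_residue`). In such coordinates the eigenvalues
of `v` are proportional to the positive integers `a` and `b`, or the linear part is scalar
with `a = b` (`Derivation.eigenvalues_of_maximal`), so their ratio is a positive rational number, or both
vanish. This contradicts reducedness (`Derivation.false_of_reduced`).

What is needed of the geometry of surfaces is read off from étale charts over the affine plane
(`SmoothProjectiveSurface.exists_chart`): the local rings at points that are not closed have
principal maximal ideals, the residue fields at generic points of curves contain transcendental
elements, and those at closed points are the field of constants.
-/

noncomputable section

/-! ### Derivations of discrete valuation rings -/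

open Polynomial in
/-- The chain rule, modulo an ideal that contains the derivatives of the coefficients. -/
lemma Derivation.eval₂_sub_mem {O O' R : Type*} [CommRing O] [CommRing O']
    [CommRing R] [Algebra R O']
    (w : Derivation R O' O') (φ : O →+* O') (I : Ideal O') (h : ∀ c, w (φ c) ∈ I) (g : O')
    (P : O[X]) :
    w (P.eval₂ φ g) - P.derivative.eval₂ φ g * w g ∈ I := by
  induction P using Polynomial.induction_on' with
  | add p q hp hq =>
    simp only [eval₂_add, map_add]
    convert add_mem hp hq using 1
    ring
  | monomial n a =>
    simp only [eval₂_monomial, derivative_monomial, Derivation.leibniz, Derivation.leibniz_pow,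
      smul_eq_mul, map_mul, _root_.map_natCast φ, nsmul_eq_mul]
    convert I.mul_mem_left (g ^ n) (h a) using 1
    ring

section DiscreteValuationRing

open IsLocalRing Polynomial

variable {O O' : Type*} [CommRing O] [CommRing O'] [IsDomain O'] [IsDiscreteValuationRing O']

/-- A nonzero polynomial can be divided by one of its coefficients, of minimal valuation, after its
coefficients are mapped into a discrete valuation ring. -/
lemma Polynomial.exists_coeff_dvd (φ : O →+* O') {Q : O[X]} (hQ : Q ≠ 0) :
    ∃ i, Q.coeff i ≠ 0 ∧ ∀ j, φ (Q.coeff i) ∣ φ (Q.coeff j) := by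
  obtain ⟨i, hi, h⟩ := Finset.exists_min_image Q.support
    (fun i => IsDiscreteValuationRing.addVal O' (φ (Q.coeff i))) (support_nonempty.mpr hQ)
  refine ⟨i, mem_support_iff.mp hi, fun j => ?_⟩
  by_cases hj : Q.coeff j = 0
  · simp [hj]
  · exact IsDiscreteValuationRing.addVal_le_iff_dvd.mp (h j (mem_support_iff.mpr hj))

/-- If every quotient of elements of `O` that lies in `O'` is congruent to an element of `O` modulo
the maximal ideal, then an element of `O'` that is algebraic over `O` has an algebraic residue. -/
lemma exists_residue_relation (φ : O →+* O') (hφ : Function.Injective φ)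
    (hres : ∀ c₁ c₂ : O, c₁ ≠ 0 → φ c₁ ∣ φ c₂ →
      ∃ d : O, ∃ r ∈ maximalIdeal O', φ c₂ = (φ d + r) * φ c₁)
    (θ : O') (hθ : ∃ Q : O[X], Q ≠ 0 ∧ Q.eval₂ φ θ = 0) :
    ∃ Q : O[X], (∃ i, Q.coeff i = 1) ∧ Q.eval₂ φ θ ∈ maximalIdeal O' := by
  obtain ⟨Q, hQ, hQθ⟩ := hθ
  obtain ⟨i, hi, hdvd⟩ := Polynomial.exists_coeff_dvd φ hQ
  have hd : ∀ j, ∃ d : O, (j = i → d = 1) ∧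
      ∃ r ∈ maximalIdeal O', φ (Q.coeff j) = (φ d + r) * φ (Q.coeff i) := by
    intro j
    by_cases hj : j = i
    · exact ⟨1, fun _ => rfl, 0, zero_mem _, by simp [hj]⟩
    · obtain ⟨d, h⟩ := hres _ _ hi (hdvd j)
      exact ⟨d, fun h => absurd h hj, h⟩
  choose d hd1 r hr hrd using hd
  refine ⟨∑ j ∈ Finset.range (Q.natDegree + 1), monomial j (d j), ⟨i, ?_⟩, ?_⟩
  · have : i < Q.natDegree + 1 := Nat.lt_succ_of_le (le_natDegree_of_ne_zero hi)
    simp [finsetSum_coeff, coeff_monomial, this, hd1]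
  · have h1 : φ (Q.coeff i) * (∑ j ∈ Finset.range (Q.natDegree + 1), (φ (d j) + r j) * θ ^ j) =
        0 := by
      rw [← hQθ, eval₂_eq_sum_range, Finset.mul_sum]
      refine Finset.sum_congr rfl fun j _ => ?_
      rw [hrd j]; ring
    have h2 := (mul_eq_zero.mp h1).resolve_left (by simpa using (map_ne_zero_iff φ hφ).mpr hi)
    have h3 : (∑ j ∈ Finset.range (Q.natDegree + 1), monomial j (d j)).eval₂ φ θ =
        -∑ j ∈ Finset.range (Q.natDegree + 1), r j * θ ^ j := by
      rw [eq_neg_iff_add_eq_zero, eval₂_finsetSum, ← Finset.sum_add_distrib, ← h2]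
      refine Finset.sum_congr rfl fun j _ => ?_
      rw [eval₂_monomial]; ring
    rw [h3]
    exact neg_mem (Ideal.sum_mem _ fun j _ => Ideal.mul_mem_right _ _ (hr j))

/-- A residue field extension of discrete valuation rings of residue characteristic zero is
separable, if it is algebraic: an element of `O'` is modulo the maximal ideal a simple root of a
polynomial over `O`. -/
lemma exists_simple_residue_root [IsDomain O] [IsDiscreteValuationRing O]
    [CharZero (ResidueField O)] (φ : O →+* O') [IsLocalHom φ]
    (hφ : Function.Injective φ) (g : O') (hg : ∃ Q : O[X], Q ≠ 0 ∧ Q.eval₂ φ g = 0) :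
    ∃ P : O[X], P.eval₂ φ g ∈ maximalIdeal O' ∧ P.derivative.eval₂ φ g ∉ maximalIdeal O' := by
  obtain ⟨Q, ⟨i, hi⟩, hQ⟩ := exists_residue_relation φ hφ (fun c₁ c₂ h₁ h => by
    rcases ValuationRing.dvd_total c₁ c₂ with ⟨d, rfl⟩ | ⟨d, rfl⟩
    · exact ⟨d, 0, zero_mem _, by simp [mul_comm]⟩
    · by_cases hd : IsUnit d
      · obtain ⟨u, rfl⟩ := hd
        exact ⟨(u⁻¹ : Oˣ), 0, zero_mem _,
          by rw [add_zero, ← map_mul]; congr 1; rw [mul_left_comm]; simp⟩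
      · exfalso
        obtain ⟨c, hc⟩ := h
        have h2 : φ c₂ ≠ 0 := (map_ne_zero_iff φ hφ).mpr fun h => h₁ (by simp [h])
        have h3 : φ d * c = 1 := mul_left_cancel₀ h2 (by rw [← mul_assoc, ← map_mul, ← hc, mul_one])
        exact hd (isUnit_of_map_unit φ _ (IsUnit.of_mul_eq_one _ h3))) g hg
  have key : ∀ P : O[X], residue O' (P.eval₂ φ g) =
      (P.map (residue O)).eval₂ (ResidueField.map φ) (residue O' g) := by
    intro P
    rw [hom_eval₂, eval₂_map]
    rfl
  let : Algebra (ResidueField O) (ResidueField O') := (ResidueField.map φ).toAlgebra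
  have hint : IsIntegral (ResidueField O) (residue O' g) := by
    refine (IsAlgebraic.isIntegral ⟨Q.map (residue O), fun h => ?_, ?_⟩)
    · have := congrArg (fun R => coeff R i) h
      simp [hi] at this
    · have := key Q
      rw [(residue_eq_zero_iff _).mpr hQ] at this
      exact this.symm
  obtain ⟨P, hP⟩ := Polynomial.map_surjective (residue O) residue_surjective
    (minpoly (ResidueField O) (residue O' g))
  refine ⟨P, ?_, ?_⟩
  · rw [← residue_eq_zero_iff, key, hP]
    exact minpoly.aeval _ _
  · rw [← residue_eq_zero_iff, key, ← derivative_map, hP]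
    exact (minpoly.irreducible hint).separable.aeval_derivative_ne_zero (minpoly.aeval _ _)

/-- The comparison of a derivation `w` of `O'` with a derivation `v` of `O`, of which it is a
multiple, for an extension of discrete valuation rings with ramification index `e`. The exponent of
the multiple is determined by whether `w` is tangent to the divisor `t = 0` or not. -/
lemma Derivation.multiple_of_ramified [IsDomain O] [IsDiscreteValuationRing O]
    [CharZero (ResidueField O)] {R : Type*} [CommRing R] [Algebra R O] [Algebra R O']
    (φ : O →+* O') [IsLocalHom φ] (hφ : Function.Injective φ)
    (halg : ∀ g : O', ∃ Q : O[X], Q ≠ 0 ∧ Q.eval₂ φ g = 0)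
    (w : Derivation R O' O') (v : Derivation R O O) (α : O')
    (hwv : ∀ b, w (φ b) = α * φ (v b)) (hw : ∃ g, IsUnit (w g))
    {s : O} (hs : Irreducible s) {t : O'} (ht : Irreducible t) {e : ℕ} (he : e ≠ 0)
    {u : O'} (hu : IsUnit u) (hst : φ s = u * t ^ e) :
    (w t ∈ maximalIdeal O' → IsUnit α) ∧ (w t ∉ maximalIdeal O' → Associated α (t ^ (e - 1))) := by
  have htm : t ∈ maximalIdeal O' := (mem_maximalIdeal _).mpr ht.not_isUnit
  constructor
  · intro hwt
    by_contra hαu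
    obtain ⟨g, hg⟩ := hw
    -- if `w` induced the zero derivation on the residues of `O`, it would do so on that of `g`
    obtain ⟨P, hP, hP'⟩ := exists_simple_residue_root φ hφ g (halg g)
    have h1 := w.eval₂_sub_mem φ (maximalIdeal O')
      (fun c => by rw [hwv]; exact Ideal.mul_mem_right _ _ ((mem_maximalIdeal _).mpr hαu)) g P
    have h2 : w (P.eval₂ φ g) ∈ maximalIdeal O' := by
      rw [ht.maximalIdeal_eq, Ideal.mem_span_singleton] at hP
      obtain ⟨c, hc⟩ := hP
      rw [hc, Derivation.leibniz]
      exact add_mem (Ideal.mul_mem_right _ _ htm) (Ideal.mul_mem_left _ _ hwt)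
    have h3 := sub_mem h2 h1
    rw [sub_sub_cancel] at h3
    rcases (maximalIdeal.isMaximal O').isPrime.mem_or_mem h3 with h | h
    · exact hP' h
    · exact (mem_maximalIdeal _).mp h hg
  · intro hwt
    obtain ⟨n, rfl⟩ := Nat.exists_eq_succ_of_ne_zero he
    have hwt' : IsUnit (w t) := by simpa using hwt
    have hchar : IsUnit ((n + 1 : ℕ) : O') := by
      have : IsUnit ((n + 1 : ℕ) : O) := by
        rw [← residue_ne_zero_iff_isUnit]
        rw [_root_.map_natCast (residue O)]
        exact Nat.cast_ne_zero.mpr he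
      simpa using this.map φ
    have hunit : IsUnit (t * w u + (n + 1 : ℕ) * u * w t) := by
      by_contra h
      have h' := (Ideal.add_mem_iff_right _ (Ideal.mul_mem_right (w u) _ htm)).mp
        ((mem_maximalIdeal _).mpr h)
      exact (mem_maximalIdeal _).mp h' ((hchar.mul hu).mul hwt')
    have h1 : α * φ (v s) = t ^ n * (t * w u + (n + 1 : ℕ) * u * w t) := by
      rw [← hwv, hst]
      simp only [Derivation.leibniz, Derivation.leibniz_pow, smul_eq_mul, nsmul_eq_mul,
        Nat.succ_sub_one, Nat.succ_eq_add_one]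
      ring
    have hvs : v s ≠ 0 := by
      intro h0
      rw [h0, map_zero, mul_zero] at h1
      exact mul_ne_zero (pow_ne_zero _ ht.ne_zero) hunit.ne_zero h1.symm
    obtain ⟨k, c, hk⟩ := IsDiscreteValuationRing.eq_unit_mul_pow_irreducible hvs hs
    have hc : IsUnit (φ c) := c.isUnit.map φ
    -- the valuations of both sides: `δ + (n + 1) * k = n` forces `k = 0`
    have hk0 : k = 0 := by
      by_contra hk0
      have h2 : t ^ (n + 1) ∣ t ^ n := by
        have h3 : t ^ (n + 1) ∣ α * φ (v s) := by
          rw [hk, map_mul, map_pow, hst, mul_pow, ← pow_mul]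
          exact Dvd.dvd.mul_left (Dvd.dvd.mul_left (Dvd.dvd.mul_left
            (pow_dvd_pow _ (Nat.le_mul_of_pos_right _ (Nat.pos_of_ne_zero hk0))) _) _) _
        rwa [h1, hunit.dvd_mul_right] at h3
      have := (pow_dvd_pow_iff ht.ne_zero ht.not_isUnit).mp h2
      omega
    have h3 : α * φ c = t ^ n * (t * w u + (n + 1 : ℕ) * u * w t) := by
      rw [← h1, hk, hk0, pow_zero, mul_one]
    have h4 : Associated (α * φ c) (t ^ n) := by
      rw [h3]
      exact associated_mul_unit_left _ _ hunit
    exact (associated_mul_unit_right α _ hc).trans h4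

end DiscreteValuationRing

/-! ### Divisorial valuations and reduced singularities -/

section ReducedSingularity

open IsLocalRing Polynomial

variable {k O O' : Type*} [Field k] [CommRing O] [IsLocalRing O] [Algebra k O]
  [CommRing O'] [IsDomain O'] [IsDiscreteValuationRing O'] [Algebra k O']

/-- Over an algebraically closed field, a residue that is not a constant is transcendental. -/
lemma aeval_notMem_maximalIdeal [IsAlgClosed k] {s : O'}
    (hs : ∀ c : k, s - algebraMap k O' c ∉ maximalIdeal O') {f : k[X]} (hf : f ≠ 0) :
    aeval s f ∉ maximalIdeal O' := by
  intro h
  have hint : IsIntegral k (residue O' s) := by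
    refine IsAlgebraic.isIntegral ⟨f, hf, ?_⟩
    rw [← residue_eq_zero_iff] at h
    rw [← h, aeval_def, aeval_def, hom_eval₂]
    rfl
  obtain ⟨c, hc⟩ := minpoly.mem_range_of_degree_eq_one k (residue O' s)
    (IsAlgClosed.degree_eq_one_of_irreducible k (minpoly.irreducible hint))
  refine hs c ?_
  rw [← residue_eq_zero_iff, map_sub, ← hc, sub_eq_zero]
  rfl

/-- Modulo a power of the maximal ideal, and modulo `z₂`, every element is a polynomial in `z₁`. -/
lemma exists_eq_aeval_add (hO : ∀ c : O, ∃ d : k, c - algebraMap k O d ∈ maximalIdeal O)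
    {z₁ z₂ : O} (hz : ∀ c ∈ maximalIdeal O, ∃ r₁ r₂, c = z₁ * r₁ + z₂ * r₂)
    (hz₁ : z₁ ∈ maximalIdeal O) (j : ℕ) (c : O) :
    ∃ (Q : k[X]) (r d : O), d ∈ maximalIdeal O ^ j ∧ c = aeval z₁ Q + z₂ * r + d := by
  induction j generalizing c with
  | zero => exact ⟨0, 0, c, by simp, by simp⟩
  | succ j ih =>
    obtain ⟨γ, hγ⟩ := hO c
    obtain ⟨r₁, r₂, hr⟩ := hz _ hγ
    obtain ⟨Q, r, d, hd, h⟩ := ih r₁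
    refine ⟨C γ + X * Q, z₁ * r + r₂, z₁ * d, ?_, ?_⟩
    · rw [pow_succ']
      exact Ideal.mul_mem_mul hz₁ hd
    · rw [sub_eq_iff_eq_add.mp hr, h]
      simp only [map_add, aeval_C, map_mul, aeval_X]
      ring

lemma aeval_mem_maximalIdeal_iff {x : O'} (hx : x ∈ maximalIdeal O') (Q : k[X]) :
    aeval x Q ∈ maximalIdeal O' ↔ Q.coeff 0 = 0 := by
  have h : aeval x Q = x * aeval x Q.divX + algebraMap k O' (Q.coeff 0) := by
    have := congrArg (aeval x) (X_mul_divX_add Q)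
    simpa only [map_add, map_mul, aeval_X, aeval_C] using this.symm
  rw [h, Ideal.add_mem_iff_right _ (Ideal.mul_mem_right _ _ hx)]
  constructor
  · intro h
    by_contra h0
    exact (mem_maximalIdeal _).mp h ((IsUnit.mk0 _ h0).map _)
  · intro h
    simp [h]

/-- Quotients of polynomials in an element of the maximal ideal have constant residues. -/
lemma exists_residue_aeval_div {x : O'} (hx : x ∈ maximalIdeal O') (P₁ P₂ : k[X])
    (h₁ : aeval x P₁ ≠ 0) (h : aeval x P₁ ∣ aeval x P₂) :
    ∃ c : k, ∃ r ∈ maximalIdeal O', aeval x P₂ = (algebraMap k O' c + r) * aeval x P₁ := by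
  have hP₁ : P₁ ≠ 0 := fun h => h₁ (by simp [h])
  obtain ⟨Q₁, hQ₁, hQ₁0⟩ := exists_eq_pow_rootMultiplicity_mul_and_not_dvd P₁ hP₁ 0
  generalize P₁.rootMultiplicity 0 = n₁ at hQ₁
  rw [C_0, sub_zero] at hQ₁ hQ₁0
  rw [X_dvd_iff] at hQ₁0
  have hU₁ : IsUnit (aeval x Q₁) := by
    by_contra hU
    exact hQ₁0 ((aeval_mem_maximalIdeal_iff hx _).mp ((mem_maximalIdeal _).mpr hU))
  -- the power of `X` dividing `P₁` divides `P₂` as well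
  have hdvd : X ^ n₁ ∣ P₂ := by
    by_cases hP₂ : P₂ = 0
    · simp [hP₂]
    obtain ⟨Q₂, hQ₂, hQ₂0⟩ := exists_eq_pow_rootMultiplicity_mul_and_not_dvd P₂ hP₂ 0
    generalize P₂.rootMultiplicity 0 = n₂ at hQ₂
    rw [C_0, sub_zero] at hQ₂ hQ₂0
    rw [X_dvd_iff] at hQ₂0
    have hU₂ : IsUnit (aeval x Q₂) := by
      by_contra hU
      exact hQ₂0 ((aeval_mem_maximalIdeal_iff hx _).mp ((mem_maximalIdeal _).mpr hU))
    rw [hQ₂]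
    refine Dvd.dvd.mul_right (pow_dvd_pow _ ?_) _
    by_contra! hlt
    have hx0 : x ≠ 0 := by
      rintro rfl
      apply h₁
      rw [hQ₁]
      simp [show n₁ ≠ 0 by omega]
    rw [hQ₁, hQ₂] at h
    simp only [map_mul, map_pow, aeval_X] at h
    rw [hU₁.mul_right_dvd, hU₂.dvd_mul_right,
      pow_dvd_pow_iff hx0 ((mem_maximalIdeal _).mp hx)] at h
    omega
  obtain ⟨Q₂, hQ₂⟩ := hdvd
  obtain ⟨V, hV⟩ := hU₁.exists_left_inv
  refine ⟨Q₂.coeff 0 / Q₁.coeff 0, V * aeval x (Q₂ - C (Q₂.coeff 0 / Q₁.coeff 0) * Q₁),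
    Ideal.mul_mem_left _ _ ((aeval_mem_maximalIdeal_iff hx _).mpr ?_), ?_⟩
  · simp [hQ₁0]
  · rw [hQ₁, hQ₂]
    simp only [map_mul, map_pow, aeval_X, map_sub, aeval_C]
    linear_combination (-(x ^ n₁ * aeval x Q₂) +
      x ^ n₁ * algebraMap k O' (Q₂.coeff 0 / Q₁.coeff 0) * aeval x Q₁) * hV

/-- A divisorial valuation does not come from a formal curve: if its residue field is not the field
of constants, then the values of `z₂` minus polynomials in `z₁` are bounded. Otherwise all elements
of `O` would be polynomials in `z₁` up to terms of arbitrarily high value, so that their quotients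
would have constant residues, and the residues of elements algebraic over `O` would be constant. -/
lemma exists_bound_of_residue [IsAlgClosed k] [IsDomain O] (φ : O →ₐ[k] O')
    [IsLocalHom (φ : O →+* O')]
    (hφ : Function.Injective φ)
    (halg : ∀ g : O', ∃ Q : O[X], Q ≠ 0 ∧ Q.eval₂ (φ : O →+* O') g = 0)
    (hO : ∀ c : O, ∃ d : k, c - algebraMap k O d ∈ maximalIdeal O)
    (hO' : ∃ θ : O', ∀ c : k, θ - algebraMap k O' c ∉ maximalIdeal O')
    {t : O'} (ht : Irreducible t)
    {z₁ z₂ : O} (hz : ∀ c ∈ maximalIdeal O, ∃ r₁ r₂, c = z₁ * r₁ + z₂ * r₂)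
    (hz₁ : z₁ ∈ maximalIdeal O) :
    ∃ N : ℕ, ∀ P : k[X], ¬ t ^ N ∣ φ (z₂ - z₁ * aeval z₁ P) := by
  by_contra! hcon
  obtain ⟨θ, hθ⟩ := hO'
  have htm : t ∈ maximalIdeal O' := (mem_maximalIdeal _).mpr ht.not_isUnit
  have hmap : ∀ c ∈ maximalIdeal O, φ c ∈ maximalIdeal O' := fun c hc =>
    ((mem_maximalIdeal _).mpr fun h => (mem_maximalIdeal _).mp hc
      (isUnit_of_map_unit (φ : O →+* O') c h))
  have hpow : ∀ n, ∀ c ∈ maximalIdeal O ^ n, t ^ n ∣ φ c := by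
    intro n c hc
    have h1 := Ideal.mem_map_of_mem (φ : O →+* O') hc
    rw [Ideal.map_pow] at h1
    have h2 := Ideal.pow_right_mono (Ideal.map_le_iff_le_comap.mpr fun c hc => hmap c hc :
      (maximalIdeal O).map (φ : O →+* O') ≤ maximalIdeal O') n h1
    rwa [ht.maximalIdeal_eq, Ideal.span_singleton_pow, Ideal.mem_span_singleton] at h2
  have happrox : ∀ N, ∀ c : O, ∃ Q : k[X], ∃ y, φ c = aeval (φ z₁) Q + t ^ N * y := by
    intro N c
    obtain ⟨P, y, hP⟩ := hcon N
    obtain ⟨Q, r, d, hd, h⟩ := exists_eq_aeval_add hO (z₁ := z₁) (z₂ := z₂ - z₁ * aeval z₁ P)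
      (fun c hc => by
        obtain ⟨r₁, r₂, rfl⟩ := hz c hc
        exact ⟨r₁ + aeval z₁ P * r₂, r₂, by ring⟩) hz₁ N c
    obtain ⟨y', hy'⟩ := hpow N d hd
    refine ⟨Q, y * φ r + y', ?_⟩
    rw [h, map_add, map_add, map_mul, hP, hy', ← aeval_algHom_apply]
    ring
  obtain ⟨Q, ⟨i, hi⟩, hQ⟩ := exists_residue_relation (φ : O →+* O') hφ (fun c₁ c₂ h₁ h => by
    have hc₁ : φ c₁ ≠ 0 := (map_ne_zero_iff φ hφ).mpr h₁
    obtain ⟨n, u, hu⟩ := IsDiscreteValuationRing.eq_unit_mul_pow_irreducible hc₁ ht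
    obtain ⟨Q₁, y₁, hQ₁⟩ := happrox (n + 1) c₁
    obtain ⟨Q₂, y₂, hQ₂⟩ := happrox (n + 1) c₂
    obtain ⟨g, hg⟩ := h
    replace hg : φ c₂ = φ c₁ * g := hg
    have ht1 : t ^ (n + 1) = t * ↑u⁻¹ * φ c₁ := by
      rw [hu, pow_succ]
      linear_combination (-(t ^ n * t)) * u.mul_inv
    have e₁ : aeval (φ z₁) Q₁ = (1 - t * ↑u⁻¹ * y₁) * φ c₁ := by
      linear_combination (-1 : O') * hQ₁ - y₁ * ht1
    have e₂ : aeval (φ z₁) Q₂ = (g - t * ↑u⁻¹ * y₂) * φ c₁ := by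
      linear_combination (-1 : O') * hQ₂ - y₂ * ht1 + hg
    have hunit : IsUnit (1 - t * ↑u⁻¹ * y₁) := by
      by_contra hnu
      refine (maximalIdeal.isMaximal O').ne_top ((Ideal.eq_top_iff_one _).mpr ?_)
      have := add_mem ((mem_maximalIdeal _).mpr hnu)
        (Ideal.mul_mem_right y₁ _ (Ideal.mul_mem_right (↑u⁻¹ : O') _ htm))
      rwa [mul_assoc, sub_add_cancel] at this
    obtain ⟨γ, r, hr, h⟩ := exists_residue_aeval_div (hmap z₁ hz₁) Q₁ Q₂
      (by rw [e₁]; exact mul_ne_zero hunit.ne_zero hc₁)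
      (by rw [e₁, e₂, mul_comm, mul_comm _ (φ c₁), mul_dvd_mul_iff_left hc₁]; exact hunit.dvd)
    refine ⟨algebraMap k O γ,
      r * (1 - t * ↑u⁻¹ * y₁) + t * (↑u⁻¹ * y₂ - algebraMap k O' γ * ↑u⁻¹ * y₁),
      add_mem (Ideal.mul_mem_right _ _ hr) (Ideal.mul_mem_right _ _ htm), ?_⟩
    change φ c₂ = (φ (algebraMap k O γ) + _) * φ c₁
    rw [AlgHom.commutes, hg]
    rw [e₁, e₂] at h
    linear_combination h) θ (halg θ)
  -- the coefficients are replaced by constants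
  obtain ⟨q, hq⟩ := Polynomial.map_surjective (algebraMap k (ResidueField O)) (fun c => by
    obtain ⟨c, rfl⟩ := residue_surjective c
    obtain ⟨γ, hγ⟩ := hO c
    refine ⟨γ, ?_⟩
    rw [← residue_eq_zero_iff, map_sub, sub_eq_zero] at hγ
    rw [hγ]
    rfl) (Q.map (residue O))
  refine aeval_notMem_maximalIdeal hθ (f := q) ?_ ?_
  · rintro rfl
    have := congrArg (fun R => coeff R i) hq
    simp [hi] at this
  · rw [← residue_eq_zero_iff] at hQ ⊢
    rw [← hQ, aeval_def, hom_eval₂, hom_eval₂]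
    have h1 : (residue O').comp (algebraMap k O') =
        (ResidueField.map (φ : O →+* O')).comp (algebraMap k (ResidueField O)) := by
      ext c
      change residue O' (algebraMap k O' c) = residue O' (φ (algebraMap k O c))
      rw [AlgHom.commutes]
    have h2 : (residue O').comp (φ : O →+* O') =
        (ResidueField.map (φ : O →+* O')).comp (residue O) := rfl
    rw [h1, h2, ← eval₂_map, ← eval₂_map, hq]

/-- A constant divisible by a uniformizer vanishes. -/
lemma eq_zero_of_irreducible_dvd_algebraMap {k O' : Type*} [Field k] [CommRing O'] [Algebra k O']
    {t : O'} (ht : Irreducible t) {c : k}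
    (h : t ∣ algebraMap k O' c) : c = 0 := by
  by_contra hc
  exact ht.not_isUnit (isUnit_of_dvd_unit h ((IsUnit.mk0 c hc).map _))

/-- If `v` is the restriction of `t • D`, then it acts on the `n`-th graded piece of the valuation
as multiplication by `n * D t`. -/
lemma Derivation.pow_succ_dvd_sub {k O O' : Type*} [CommRing k] [CommRing O] [Algebra k O]
    [CommRing O'] [Algebra k O'] (φ : O →ₐ[k] O') (v : Derivation k O O) (D : Derivation k O' O')
    {t : O'} (hv : ∀ b, φ (v b) = t * D (φ b)) {n : ℕ} {c : O} (hc : t ^ n ∣ φ c) :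
    t ^ (n + 1) ∣ φ (v c) - n * D t * φ c := by
  obtain ⟨y, hy⟩ := hc
  refine ⟨D y, ?_⟩
  rw [hv, hy]
  rcases n with _ | n
  · simp
  · simp only [Derivation.leibniz, Derivation.leibniz_pow, smul_eq_mul, nsmul_eq_mul,
      Nat.add_sub_cancel]
    ring

/-- The eigenvalues of `v`, in coordinates `z₁` and `z₂` whose values `a` and `b` under a divisorial
valuation are as different as possible, are proportional to `a` and `b`. If `a = b`, then the
transcendental residue of `z₂ / z₁` satisfies a quadratic equation over the constants, whose
coefficients must vanish; if `a < b`, the inequality `a * α₂₂ ≠ b * α₁₁` would allow to cancel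
the leading term of `z₂` by a polynomial in `z₁`. -/
lemma Derivation.eigenvalues_of_maximal [IsAlgClosed k] [CharZero k] [IsDomain O] (φ : O →ₐ[k] O')
    [IsLocalHom (φ : O →+* O')]
    (hO : ∀ c : O, ∃ d : k, c - algebraMap k O d ∈ maximalIdeal O)
    {t : O'} (ht : Irreducible t)
    (v : Derivation k O O) (D : Derivation k O' O') (hv : ∀ b, φ (v b) = t * D (φ b))
    {z₁ z₂ : O} (hz₁ : z₁ ∈ maximalIdeal O)
    (hz : ∀ c ∈ maximalIdeal O, ∃ r₁ r₂, c = z₁ * r₁ + z₂ * r₂)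
    {a b : ℕ} (hab : a ≤ b) {u₁ u₂ : O'} (hu₁ : IsUnit u₁)
    (hza : φ z₁ = u₁ * t ^ a) (hzb : φ z₂ = u₂ * t ^ b)
    (hmax : ∀ P : k[X], ¬ t ^ (b + 1) ∣ φ (z₂ - z₁ * aeval z₁ P))
    {α₁₁ α₁₂ α₂₁ α₂₂ : k} {e₁ e₂ : O}
    (he₁ : ∃ c₁ ∈ maximalIdeal O, ∃ c₂ ∈ maximalIdeal O, e₁ = z₁ * c₁ + z₂ * c₂)
    (he₂ : ∃ c₁ ∈ maximalIdeal O, ∃ c₂ ∈ maximalIdeal O, e₂ = z₁ * c₁ + z₂ * c₂)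
    (h₁ : v z₁ = algebraMap k O α₁₁ * z₁ + algebraMap k O α₁₂ * z₂ + e₁)
    (h₂ : v z₂ = algebraMap k O α₂₁ * z₁ + algebraMap k O α₂₂ * z₂ + e₂) :
    α₂₁ = 0 ∧ a * α₂₂ = b * α₁₁ := by
  have hmap : ∀ c ∈ maximalIdeal O, t ∣ φ c := fun c hc => by
    rw [← Ideal.mem_span_singleton, ← ht.maximalIdeal_eq, mem_maximalIdeal]
    exact fun h => (mem_maximalIdeal _).mp hc (isUnit_of_map_unit (φ : O →+* O') c h)
  have hpow : ∀ n, ∀ c ∈ maximalIdeal O ^ n, t ^ n ∣ φ c := by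
    intro n c hc
    have h1 := Ideal.mem_map_of_mem (φ : O →+* O') hc
    rw [Ideal.map_pow] at h1
    have h2 := Ideal.pow_right_mono (Ideal.map_le_iff_le_comap.mpr fun c hc =>
      Ideal.mem_span_singleton.mpr (hmap c hc) :
      (maximalIdeal O).map (φ : O →+* O') ≤ Ideal.span {t}) n h1
    rwa [Ideal.span_singleton_pow, Ideal.mem_span_singleton] at h2
  have hcancel : ∀ x, t ^ (a + 1) ∣ x * φ z₁ → t ∣ x := by
    intro x hx
    rw [hza, pow_succ', show x * (u₁ * t ^ a) = u₁ * x * t ^ a by ring] at hx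
    exact hu₁.dvd_mul_left.mp ((mul_dvd_mul_iff_right (pow_ne_zero a ht.ne_zero)).mp hx)
  have hzbd : t ^ b ∣ φ z₂ := ⟨u₂, by rw [hzb, mul_comm]⟩
  have hzad : t ^ a ∣ φ z₁ := ⟨u₁, by rw [hza, mul_comm]⟩
  obtain ⟨s, hs⟩ : φ z₁ ∣ φ z₂ := by
    rw [hza, hzb, hu₁.mul_left_dvd]
    exact Dvd.dvd.mul_left (pow_dvd_pow _ hab) _
  -- the terms of order at least two do not contribute in degree `a`
  have hhigh : ∀ e : O, (∃ c₁ ∈ maximalIdeal O, ∃ c₂ ∈ maximalIdeal O, e = z₁ * c₁ + z₂ * c₂) →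
      t ^ (a + 1) ∣ φ e := by
    rintro e ⟨c₁, hc₁, c₂, hc₂, rfl⟩
    rw [map_add, map_mul, map_mul, pow_succ]
    exact dvd_add (mul_dvd_mul hzad (hmap _ hc₁))
      (mul_dvd_mul ((pow_dvd_pow _ hab).trans hzbd) (hmap _ hc₂))
  have hv₁ := Derivation.pow_succ_dvd_sub φ v D hv hzad
  have hv₂ := Derivation.pow_succ_dvd_sub φ v D hv hzbd
  have k₁ : t ∣ algebraMap k O' α₁₁ + algebraMap k O' α₁₂ * s - a * D t := by
    refine hcancel _ ?_
    have h3 := dvd_sub hv₁ (hhigh e₁ he₁)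
    rw [h₁] at h3
    simp only [map_add, map_mul, AlgHom.commutes, hs] at h3
    convert h3 using 1
    ring
  rcases hab.eq_or_lt with rfl | hlt
  · -- equal values: the residue of `z₂ / z₁` is transcendental over the constants
    have k₂ : t ∣ algebraMap k O' α₂₁ + algebraMap k O' α₂₂ * s - a * D t * s := by
      refine hcancel _ ?_
      have h3 := dvd_sub hv₂ (hhigh e₂ he₂)
      rw [h₂] at h3
      simp only [map_add, map_mul, AlgHom.commutes, hs] at h3
      convert h3 using 1
      ring
    have hst : ∀ c : k, s - algebraMap k O' c ∉ maximalIdeal O' := by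
      intro c hc
      rw [ht.maximalIdeal_eq, Ideal.mem_span_singleton] at hc
      refine hmax (C c) ?_
      have h3 := mul_dvd_mul hzad hc
      rw [← pow_succ] at h3
      convert h3 using 1
      simp only [map_sub, map_mul, aeval_C, AlgHom.commutes, hs]
      ring
    have hquad : C α₁₂ * X ^ 2 + C (α₁₁ - α₂₂) * X + C (-α₂₁) = 0 := by
      by_contra hne
      refine aeval_notMem_maximalIdeal hst hne ?_
      rw [ht.maximalIdeal_eq, Ideal.mem_span_singleton]
      have h3 := dvd_sub (Dvd.dvd.mul_right k₁ s) k₂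
      convert h3 using 1
      simp only [map_add, map_mul, aeval_C, aeval_X, map_pow, map_sub, map_neg]
      ring
    have c0 := congrArg (fun P => coeff P 0) hquad
    have c1 := congrArg (fun P => coeff P 1) hquad
    simp [coeff_X, coeff_C] at c0 c1
    refine ⟨c0, ?_⟩
    rw [sub_eq_zero.mp c1]
  · have hlt' : t ^ (a + 1) ∣ φ z₂ := (pow_dvd_pow _ hlt).trans hzbd
    have hα : α₂₁ = 0 := by
      refine eq_zero_of_irreducible_dvd_algebraMap ht (hcancel _ ?_)
      have h3 := (pow_dvd_pow t (show a + 1 ≤ b + 1 by omega)).trans hv₂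
      have h4 := dvd_sub (dvd_add h3 (Dvd.dvd.mul_left hlt' (b * D t)))
        (dvd_add (hhigh e₂ he₂) (Dvd.dvd.mul_left hlt' (algebraMap k O' α₂₂)))
      rw [h₂] at h4
      simp only [map_add, map_mul, AlgHom.commutes] at h4
      convert h4 using 1
      ring
    refine ⟨hα, ?_⟩
    have k₁' : t ∣ algebraMap k O' α₁₁ - a * D t := by
      refine hcancel _ ?_
      have h4 := dvd_sub hv₁ (dvd_add (hhigh e₁ he₁) (Dvd.dvd.mul_left hlt' (algebraMap k O' α₁₂)))
      rw [h₁] at h4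
      simp only [map_add, map_mul, AlgHom.commutes] at h4
      convert h4 using 1
      ring
    -- otherwise a polynomial in `z₁` could be subtracted from `z₂` to raise its value
    by_contra hne
    obtain ⟨c₁, hc₁, c₂, hc₂, rfl⟩ := he₂
    obtain ⟨Q, r, d, hd, hQ⟩ := exists_eq_aeval_add hO hz hz₁ (b + 1) c₁
    have hκ : (a * α₂₂ - b * α₁₁ : k) ≠ 0 := sub_ne_zero.mpr hne
    refine hmax (C (-(a / (a * α₂₂ - b * α₁₁))) * Q) ?_
    have d₁ : t ^ (b + 1) ∣ φ z₂ * φ c₂ := by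
      rw [pow_succ]
      exact mul_dvd_mul hzbd (hmap _ hc₂)
    have d₂ : t ^ (b + 1) ∣ φ z₂ * φ z₁ := by
      rw [pow_succ]
      exact mul_dvd_mul hzbd (hmap _ hz₁)
    have d₃ : t ^ (b + 1) ∣ φ z₂ * (algebraMap k O' α₁₁ - a * D t) := by
      rw [pow_succ]
      exact mul_dvd_mul hzbd k₁'
    have h5 := dvd_sub (Dvd.dvd.mul_left hv₂ (a : O')) (dvd_add (dvd_add
      (Dvd.dvd.mul_left d₁ (a : O'))
      (Dvd.dvd.mul_left d₂ (a * φ r))) (dvd_add (Dvd.dvd.mul_left (hpow _ d hd) (a * φ z₁))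
        (Dvd.dvd.mul_left d₃ (b : O'))))
    have h6 : t ^ (b + 1) ∣ algebraMap k O' (a * α₂₂ - b * α₁₁) * φ z₂ +
        a * φ z₁ * aeval (φ z₁) Q := by
      rw [h₂, hα, hQ] at h5
      simp only [map_add, map_mul, AlgHom.commutes, map_zero, ← aeval_algHom_apply] at h5
      convert h5 using 1
      simp only [map_sub, map_mul, _root_.map_natCast]
      ring
    have h7 := Dvd.dvd.mul_left h6 (algebraMap k O' (a * α₂₂ - b * α₁₁)⁻¹)
    convert h7 using 1
    have hinv : algebraMap k O' (a * α₂₂ - b * α₁₁)⁻¹ *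
        algebraMap k O' (a * α₂₂ - b * α₁₁) = 1 := by
      rw [← map_mul, inv_mul_cancel₀ hκ, map_one]
    rw [map_sub, map_mul, ← aeval_algHom_apply]
    simp only [map_mul, aeval_C, map_neg, div_eq_mul_inv, _root_.map_natCast]
    linear_combination (-φ z₂) * hinv

lemma exists_eq_of_mem_maximalIdeal_sq {O : Type*} [CommRing O] [IsLocalRing O] {z₁ z₂ : O}
    (hz : ∀ c ∈ maximalIdeal O, ∃ r₁ r₂, c = z₁ * r₁ + z₂ * r₂) {e : O}
    (he : e ∈ maximalIdeal O ^ 2) :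
    ∃ c₁ ∈ maximalIdeal O, ∃ c₂ ∈ maximalIdeal O, e = z₁ * c₁ + z₂ * c₂ := by
  rw [pow_two] at he
  induction he using Submodule.mul_induction_on' with
  | mem_mul_mem x hx y hy =>
    obtain ⟨r₁, r₂, rfl⟩ := hz x hx
    exact ⟨r₁ * y, Ideal.mul_mem_left _ _ hy, r₂ * y, Ideal.mul_mem_left _ _ hy, by ring⟩
  | add x _ y _ hx hy =>
    obtain ⟨c₁, h₁, c₂, h₂, rfl⟩ := hx
    obtain ⟨d₁, h₃, d₂, h₄, rfl⟩ := hy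
    exact ⟨c₁ + d₁, add_mem h₁ h₃, c₂ + d₂, add_mem h₂ h₄, by ring⟩

/-- A vector field `v` on a surface germ that extends to a vector field vanishing along a divisor
contracted to the germ has a linear part whose eigenvalues `μ₁` and `μ₂` have a positive rational
ratio, or both vanish. -/
lemma Derivation.eigenvalues_proportional [IsAlgClosed k] [CharZero k] [IsDomain O] (φ : O →ₐ[k] O')
    [IsLocalHom (φ : O →+* O')] (hφ : Function.Injective φ)
    (halg : ∀ g : O', ∃ Q : O[X], Q ≠ 0 ∧ Q.eval₂ (φ : O →+* O') g = 0)
    (hO : ∀ c : O, ∃ d : k, c - algebraMap k O d ∈ maximalIdeal O)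
    (hO' : ∃ θ : O', ∀ c : k, θ - algebraMap k O' c ∉ maximalIdeal O')
    {t : O'} (ht : Irreducible t)
    (v : Derivation k O O) (D : Derivation k O' O') (hv : ∀ b, φ (v b) = t * D (φ b))
    {z₁ z₂ : O} (hz₁ : z₁ ∈ maximalIdeal O) (hz₂ : z₂ ∈ maximalIdeal O)
    (hz : ∀ c ∈ maximalIdeal O, ∃ r₁ r₂, c = z₁ * r₁ + z₂ * r₂)
    (hdvd : φ z₁ ∣ φ z₂) {a₁₁ a₁₂ a₂₁ a₂₂ : k} {e₁ e₂ : O}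
    (he₁ : e₁ ∈ maximalIdeal O ^ 2) (he₂ : e₂ ∈ maximalIdeal O ^ 2)
    (h₁ : v z₁ = algebraMap k O a₁₁ * z₁ + algebraMap k O a₁₂ * z₂ + e₁)
    (h₂ : v z₂ = algebraMap k O a₂₁ * z₁ + algebraMap k O a₂₂ * z₂ + e₂) :
    ∃ a b : ℕ, 0 < a ∧ 0 < b ∧ ∃ μ₁ μ₂ : k, a * μ₂ = b * μ₁ ∧ a₁₁ + a₂₂ = μ₁ + μ₂ ∧
      a₁₁ * a₂₂ - a₁₂ * a₂₁ = μ₁ * μ₂ := by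
  classical
  have hsq : ∀ x ∈ maximalIdeal O, ∀ y ∈ maximalIdeal O, x * y ∈ maximalIdeal O ^ 2 :=
    fun x hx y hy => by rw [pow_two]; exact Ideal.mul_mem_mul hx hy
  have hbound := exists_bound_of_residue φ hφ halg hO hO' ht hz hz₁
  -- the exponent `b` is maximal
  obtain ⟨N, hN⟩ : ∃ N, Nat.find hbound = N := ⟨_, rfl⟩
  have hN1 := Nat.find_spec hbound
  have hN2 : ∀ m < N, ∃ P : k[X], t ^ m ∣ φ (z₂ - z₁ * aeval z₁ P) := by
    intro m hm
    have := Nat.find_min hbound (hN.symm ▸ hm)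
    push Not at this
    exact this
  rw [hN] at hN1
  obtain ⟨b, rfl⟩ : ∃ b, N = b + 1 := Nat.exists_eq_succ_of_ne_zero (by
    rintro rfl
    exact hN1 0 (by simp))
  obtain ⟨P, u₂, hb⟩ := hN2 b (Nat.lt_succ_self b)
  have hz₁0 : φ z₁ ≠ 0 := by
    intro h0
    apply hN1 0
    rw [h0, zero_dvd_iff] at hdvd
    simp [hdvd]
  obtain ⟨a, u₁, hza⟩ := IsDiscreteValuationRing.eq_unit_mul_pow_irreducible hz₁0 ht
  have ha : 0 < a := by
    by_contra h
    rw [Nat.eq_zero_of_not_pos h, pow_zero, mul_one] at hza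
    exact (mem_maximalIdeal _).mp hz₁ (isUnit_of_map_unit (φ : O →+* O') z₁
      (by change IsUnit (φ z₁); rw [hza]; exact u₁.isUnit))
  have hab : a ≤ b := by
    by_contra h
    refine hN1 0 ((pow_dvd_pow t (show b + 1 ≤ a by omega)).trans ?_)
    refine Dvd.dvd.trans ⟨(u₁ : O'), by rw [hza, mul_comm]⟩ (hdvd.trans ?_)
    simp
  set y := z₂ - z₁ * aeval z₁ P with hy
  have hym : y ∈ maximalIdeal O := sub_mem hz₂ (Ideal.mul_mem_right _ _ hz₁)
  have hzy : ∀ c ∈ maximalIdeal O, ∃ r₁ r₂, c = z₁ * r₁ + y * r₂ := by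
    intro c hc
    obtain ⟨r₁, r₂, rfl⟩ := hz c hc
    exact ⟨r₁ + aeval z₁ P * r₂, r₂, by rw [hy]; ring⟩
  have hvz : v z₁ ∈ maximalIdeal O := by
    rw [h₁]
    exact add_mem (add_mem (Ideal.mul_mem_left _ _ hz₁) (Ideal.mul_mem_left _ _ hz₂))
      (Ideal.pow_le_self two_ne_zero he₁)
  obtain ⟨Q, hQ⟩ : ∃ Q : O, aeval z₁ P = algebraMap k O (P.coeff 0) + z₁ * Q := by
    refine ⟨aeval z₁ P.divX, ?_⟩
    have := congrArg (aeval z₁) (X_mul_divX_add P)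
    simp only [map_add, map_mul, aeval_X, aeval_C] at this
    rw [← this, add_comm]
  generalize P.coeff 0 = p at hQ
  have hvy : v y = v z₂ - algebraMap k O p * v z₁ - z₁ * (Q * v z₁ + v (aeval z₁ P)) := by
    rw [hy, map_sub, Derivation.leibniz, smul_eq_mul, smul_eq_mul, mul_comm _ (v z₁), hQ]
    ring
  have hvP : v (aeval z₁ P) ∈ maximalIdeal O := by
    have : v (aeval z₁ P) - (derivative P).eval₂ (algebraMap k O) z₁ * v z₁ ∈ (⊥ : Ideal O) :=
      v.eval₂_sub_mem (algebraMap k O) ⊥ (fun c => by simp) z₁ P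
    rw [Ideal.mem_bot, sub_eq_zero] at this
    rw [this]
    exact Ideal.mul_mem_left _ _ hvz
  have hz₂y : z₂ = y + algebraMap k O p * z₁ + z₁ * (z₁ * Q) := by rw [hy, hQ]; ring
  have hE : z₁ * (z₁ * Q) ∈ maximalIdeal O ^ 2 := hsq _ hz₁ _ (Ideal.mul_mem_right _ _ hz₁)
  -- the linear part of `v` in the coordinates `z₁` and `y`, which agrees with `z₂ - p z₁` up to
  -- terms of order two, is conjugate to the given one
  have key := Derivation.eigenvalues_of_maximal φ hO ht v D hv hz₁ hzy hab u₁.isUnit hza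
    (by rw [hb, mul_comm]) (fun R hR => hN1 (P + R) (by
      convert hR using 2
      rw [hy, map_add]
      ring)) (α₁₁ := a₁₁ + p * a₁₂) (α₁₂ := a₁₂)
    (α₂₁ := a₂₁ + a₂₂ * p - p * a₁₁ - p ^ 2 * a₁₂) (α₂₂ := a₂₂ - p * a₁₂)
    (e₁ := algebraMap k O a₁₂ * (z₁ * (z₁ * Q)) + e₁)
    (e₂ := algebraMap k O (a₂₂ - p * a₁₂) * (z₁ * (z₁ * Q)) + e₂ - algebraMap k O p * e₁ -
      z₁ * (Q * v z₁ + v (aeval z₁ P)))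
    (exists_eq_of_mem_maximalIdeal_sq hzy (add_mem (Ideal.mul_mem_left _ _ hE) he₁))
    (exists_eq_of_mem_maximalIdeal_sq hzy (sub_mem (sub_mem
      (add_mem (Ideal.mul_mem_left _ _ hE) he₂)
      (Ideal.mul_mem_left _ _ he₁)) (hsq _ hz₁ _ (add_mem (Ideal.mul_mem_left _ _ hvz) hvP))))
    (by
      rw [h₁]
      simp only [map_add, map_mul]
      linear_combination algebraMap k O a₁₂ * hz₂y)
    (by
      rw [hvy, h₁, h₂]
      simp only [map_add, map_mul, map_sub, map_pow]
      linear_combination (algebraMap k O a₂₂ - algebraMap k O p * algebraMap k O a₁₂) * hz₂y)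
  refine ⟨a, b, ha, ha.trans_le hab, a₁₁ + p * a₁₂, a₂₂ - p * a₁₂, key.2, by ring, ?_⟩
  linear_combination (-a₁₂) * key.1

/-- A vector field with a reduced singularity does not extend to a vector field vanishing along
a divisor that is contracted to the singular point. -/
lemma Derivation.false_of_reduced {O O' : Type*} [CommRing O] [IsLocalRing O] [Algebra ℂ O]
    [CommRing O'] [IsDomain O'] [IsDiscreteValuationRing O'] [Algebra ℂ O'] [IsDomain O]
    (φ : O →ₐ[ℂ] O')
    [IsLocalHom (φ : O →+* O')] (hφ : Function.Injective φ)
    (halg : ∀ g : O', ∃ Q : O[X], Q ≠ 0 ∧ Q.eval₂ (φ : O →+* O') g = 0)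
    (hO : ∀ c : O, ∃ d : ℂ, c - algebraMap ℂ O d ∈ maximalIdeal O)
    (hO' : ∃ θ : O', ∀ c : ℂ, θ - algebraMap ℂ O' c ∉ maximalIdeal O')
    {t : O'} (ht : Irreducible t)
    (v : Derivation ℂ O O) (D : Derivation ℂ O' O') (hv : ∀ b, φ (v b) = t * D (φ b))
    (z : Fin 2 → O) (hz : maximalIdeal O = Ideal.span (Set.range z))
    (A : Matrix (Fin 2) (Fin 2) ℂ)
    (hA : ∀ i, ∃ e ∈ maximalIdeal O ^ 2, v (z i) = ∑ j, algebraMap ℂ O (A i j) * z j + e)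
    {l m : ℂ} (hlm : A.charpoly = (X - C l) * (X - C m)) (hm : m ≠ 0)
    (hr : ∀ r : ℚ, 0 < r → l / m ≠ (r : ℂ)) : False := by
  have hzm : ∀ i, z i ∈ maximalIdeal O := fun i => by
    rw [hz]
    exact Ideal.subset_span ⟨i, rfl⟩
  have hz' : ∀ c ∈ maximalIdeal O, ∃ r₁ r₂, c = z 0 * r₁ + z 1 * r₂ := by
    intro c hc
    rw [hz, Ideal.mem_span_range_iff_exists_fun] at hc
    obtain ⟨r, rfl⟩ := hc
    exact ⟨r 0, r 1, by rw [Fin.sum_univ_two]; ring⟩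
  obtain ⟨e₁, he₁, h₁⟩ := hA 0
  obtain ⟨e₂, he₂, h₂⟩ := hA 1
  rw [Fin.sum_univ_two] at h₁ h₂
  have key : ∃ a b : ℕ, 0 < a ∧ 0 < b ∧ ∃ μ₁ μ₂ : ℂ, a * μ₂ = b * μ₁ ∧
      A 0 0 + A 1 1 = μ₁ + μ₂ ∧ A 0 0 * A 1 1 - A 0 1 * A 1 0 = μ₁ * μ₂ := by
    rcases ValuationRing.dvd_total (φ (z 0)) (φ (z 1)) with h | h
    · exact Derivation.eigenvalues_proportional φ hφ halg hO hO' ht v D hv (hzm 0) (hzm 1) hz' h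
        he₁ he₂ h₁ h₂
    · obtain ⟨a, b, ha, hb, μ₁, μ₂, h₃, h₄, h₅⟩ :=
        Derivation.eigenvalues_proportional φ hφ halg hO hO' ht v D hv (hzm 1) (hzm 0)
          (fun c hc => by
            obtain ⟨r₁, r₂, rfl⟩ := hz' c hc
            exact ⟨r₂, r₁, add_comm _ _⟩) h
          he₂ he₁ (h₂.trans (by rw [add_comm (algebraMap ℂ O (A 1 0) * z 0)]))
          (h₁.trans (by rw [add_comm (algebraMap ℂ O (A 0 0) * z 0)]))
      exact ⟨a, b, ha, hb, μ₁, μ₂, h₃, by rw [add_comm, h₄], by linear_combination h₅⟩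
  obtain ⟨a, b, ha, hb, μ₁, μ₂, hμ, htr, hdet⟩ := key
  have hc1 := congrArg (eval (0 : ℂ)) hlm
  have hc2 := congrArg (eval (1 : ℂ)) hlm
  rw [Matrix.charpoly_fin_two, Matrix.trace_fin_two, Matrix.det_fin_two] at hc1 hc2
  simp only [eval_add, eval_sub, eval_mul, eval_pow, eval_X, eval_C] at hc1 hc2
  have hprod : l * m = μ₁ * μ₂ := by linear_combination hdet - hc1
  have hsum : l + m = μ₁ + μ₂ := by linear_combination hprod + htr - hdet + hc2
  have ha' : (a : ℂ) ≠ 0 := Nat.cast_ne_zero.mpr ha.ne'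
  have hb' : (b : ℂ) ≠ 0 := Nat.cast_ne_zero.mpr hb.ne'
  have h3 : (m - μ₁) * (m - μ₂) = 0 := by linear_combination m * hsum - hprod
  rcases mul_eq_zero.mp h3 with h | h
  · have hm' : m = μ₁ := sub_eq_zero.mp h
    have hl : l = μ₂ := by linear_combination hsum - hm'
    refine hr (b / a) (by positivity) ?_
    rw [div_eq_iff hm, hl, hm']
    push_cast
    field_simp
    linear_combination hμ
  · have hm' : m = μ₂ := sub_eq_zero.mp h
    have hl : l = μ₁ := by linear_combination hsum - hm'
    refine hr (a / b) (by positivity) ?_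
    rw [div_eq_iff hm, hl, hm']
    push_cast
    field_simp
    linear_combination -hμ

end ReducedSingularity

/-! ### Étale charts of smooth surfaces -/

section EtaleChart

open IsLocalRing

lemma Ideal.exists_eq_span_singleton_of_height_le_one {M : Type*} [CommRing M] [IsDomain M]
    [UniqueFactorizationMonoid M] (P : Ideal M) [P.IsPrime] (h : P.height ≤ 1) :
    ∃ a, P = Ideal.span {a} := by
  by_cases hP : P = ⊥
  · exact ⟨0, by simp [hP]⟩
  obtain ⟨x, hx, hxp⟩ := Ideal.IsPrime.exists_mem_prime_of_ne_bot (I := P) ‹_› hP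
  refine ⟨x, Ideal.eq_span_singleton_of_height_eq_one (le_antisymm h ?_) hx hxp⟩
  rw [Order.one_le_iff_ne_zero, Ne, Ideal.height_eq_zero_iff_eq_bot]
  exact hP

lemma MvPolynomial.height_le_one_of_not_isMaximal {k : Type*} [Field k]
    (P : Ideal (MvPolynomial (Fin 2) k)) [P.IsPrime] (h : ¬ P.IsMaximal) : P.height ≤ 1 := by
  obtain ⟨Q, hQ, hPQ⟩ := Ideal.exists_le_maximal P (Ideal.IsPrime.ne_top ‹_›)
  have hlt : P < Q := lt_of_le_of_ne hPQ (by rintro rfl; exact h hQ)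
  have h1 := Ideal.height_add_one_le_of_lt_of_isPrime hlt
  have h2 := Ideal.height_le_ringKrullDim_of_ne_top hQ.ne_top
  rw [MvPolynomial.ringKrullDim_of_isNoetherianRing, ringKrullDim_eq_zero_of_field, zero_add,
    Nat.card_fin] at h2
  have h3 : Q.height ≤ 2 :=
    WithBot.coe_le_coe.mp (h2 : (Q.height : WithBot ℕ∞) ≤ ((2 : ℕ∞) : WithBot ℕ∞))
  have h4 := h1.trans h3
  rw [show (2 : ℕ∞) = 1 + 1 from by norm_num] at h4
  exact (ENat.add_le_add_iff_right (by simp)).mp h4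

/-- A principal ideal of the polynomial ring in two variables is not the ideal of a point. -/
lemma MvPolynomial.exists_sub_C_notMem {k : Type*} [Field k]
    (P : Ideal (MvPolynomial (Fin 2) k)) [P.IsPrime] (hP : ∃ a, P = Ideal.span {a}) :
    ∃ i : Fin 2, ∀ c : k, X i - C c ∉ P := by
  obtain ⟨a, rfl⟩ := hP
  by_contra! h
  obtain ⟨c₀, h₀⟩ := h 0
  obtain ⟨c₁, h₁⟩ := h 1
  rw [Ideal.mem_span_singleton] at h₀ h₁
  have hd : ∀ (i : Fin 2) (c : k), a ∣ X i - C c → ∀ j, j ≠ i → a.degreeOf j = 0 := by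
    rintro i c ⟨b, hb⟩ j hj
    have hne : (X i - C c : MvPolynomial (Fin 2) k) ≠ 0 := by
      intro h0
      have := congrArg (MvPolynomial.eval fun _ => c + 1) h0
      simp at this
    have ha : a ≠ 0 := by rintro rfl; simp [hne] at hb
    have hb0 : b ≠ 0 := by rintro rfl; simp [hne] at hb
    have h1 : (X i - C c : MvPolynomial (Fin 2) k).degreeOf j = 0 := by
      refine Nat.le_zero.mp ((degreeOf_sub_le _ _ _).trans ?_)
      simp [degreeOf_X, hj]
    rw [hb, degreeOf_mul_eq ha hb0] at h1
    omega
  have hC : a = C (a.coeff 0) := by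
    ext m
    rw [coeff_C]
    split_ifs with hm
    · rw [hm]
    · by_contra hc
      obtain ⟨j, hj⟩ := Finsupp.ne_iff.mp (Ne.symm hm)
      have h1 : m j ≤ a.degreeOf j := monomial_le_degreeOf j (mem_support_iff.mpr hc)
      have h2 : a.degreeOf j = 0 := by
        fin_cases j
        · exact hd 1 c₁ h₁ 0 (by decide)
        · exact hd 0 c₀ h₀ 1 (by decide)
      simp at hj
      omega
  refine (inferInstance : (Ideal.span {a}).IsPrime).ne_top ?_
  rw [Ideal.span_singleton_eq_top, hC]
  refine (IsUnit.mk0 _ fun h0 => ?_).map C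
  rw [hC, h0, C_0, zero_dvd_iff] at h₀
  have := congrArg (MvPolynomial.eval fun _ => c₀ + 1) h₀
  simp at this

variable {M B : Type*} [CommRing M] [CommRing B] [Algebra M B] [Algebra.Etale M B]

/-- A prime that lies over a maximal ideal under an étale homomorphism is maximal. -/
lemma Algebra.Etale.isMaximal_of_comap (q : Ideal B) [q.IsPrime] (h : (q.under M).IsMaximal) :
    q.IsMaximal := by
  obtain ⟨Q, hQ, hqQ⟩ := Ideal.exists_le_maximal q (Ideal.IsPrime.ne_top ‹_›)
  have : q = Q := Algebra.QuasiFinite.eq_of_le_of_under_eq (R := M) q Q hqQ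
    (h.eq_of_le (Ideal.IsPrime.ne_top (Ideal.IsPrime.under M Q)) (Ideal.comap_mono hqQ))
  rwa [this]

/-- The maximal ideal of a local ring of an étale algebra is generated by the prime below. -/
lemma Algebra.Etale.map_under_eq_maximalIdeal (q : Ideal B) [q.IsPrime] (L : Type*)
    [CommRing L] [IsLocalRing L] [Algebra B L] [IsLocalization.AtPrime L q] :
    (q.under M).map ((algebraMap B L).comp (algebraMap M B)) = maximalIdeal L := by
  let p := q.under M
  let := Localization.AtPrime.algebraOfLiesOver p q
  have h := ((Algebra.isUnramifiedAt_iff_map_eq M p q).mp inferInstance).2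
  let e := (IsLocalization.algEquiv q.primeCompl (Localization.AtPrime q) L)
  have h2 := congrArg (Ideal.map (e : Localization.AtPrime q →+* L)) h
  rw [Ideal.map_map] at h2
  have h3 : (maximalIdeal (Localization.AtPrime q)).map (e : Localization.AtPrime q →+* L) =
      maximalIdeal L :=
    map_maximalIdeal_of_surjective _ e.surjective
  rw [h3] at h2
  rw [← h2]
  congr 1
  ext x
  change _ = e (algebraMap M (Localization.AtPrime q) x)
  rw [IsScalarTower.algebraMap_apply M B (Localization.AtPrime q), AlgEquiv.commutes]
  rfl

lemma Algebra.Etale.height_under_le [IsNoetherianRing M] [IsNoetherianRing B]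
    (q : Ideal B) [q.IsPrime] : (q.under M).height ≤ q.height := by
  rw [Ideal.height_eq_height_add_of_liesOver_of_hasGoingDown (q.under M) q]
  exact le_self_add

end EtaleChart

/-- The residue fields at closed points of algebras of finite type over an algebraically closed
field consist of constants. -/
lemma exists_sub_algebraMap_mem_of_isMaximal {k B : Type*} [Field k] [IsAlgClosed k] [CommRing B]
    [Algebra k B] [Algebra.FiniteType k B] (q : Ideal B) (hq : q.IsMaximal) (b : B) :
    ∃ c : k, b - algebraMap k B c ∈ q := by
  let := Ideal.Quotient.field q
  have : Module.Finite k (B ⧸ q) := finite_of_finite_type_of_isJacobsonRing k (B ⧸ q)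
  obtain ⟨c, hc⟩ := (IsAlgClosed.algebraMap_bijective_of_isIntegral (k := k) (K := B ⧸ q)).2
    (Ideal.Quotient.mk q b)
  refine ⟨c, ?_⟩
  rw [← Ideal.Quotient.eq, ← hc]
  rfl

/-! ### Local rings of smooth projective surfaces -/

namespace SmoothProjectiveSurface

open IsLocalRing

variable (S : SmoothProjectiveSurface)

instance (x : S.X) : Algebra ℂ (S.O x) := (S.const x).toAlgebra

/-- The constant sections over an open set. -/
def constSection (V : S.X.Opens) : ℂ →+* Γ(S.X, V) :=
  ((Scheme.ΓSpecIso (CommRingCat.of ℂ)).inv ≫ S.str.appTop ≫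
    S.X.presheaf.map (homOfLE le_top).op).hom

lemma germ_constSection (V : S.X.Opens) (x : S.X) (hx : x ∈ V) (c : ℂ) :
    S.X.presheaf.germ V x hx (S.constSection V c) = S.const x c := by
  rw [const, constSection, ← CommRingCat.comp_apply, Category.assoc, Category.assoc,
    TopCat.Presheaf.germ_res]

lemma stalkSpecializes_const {x q : S.X} (h : x ⤳ q) (c : ℂ) :
    S.X.presheaf.stalkSpecializes h (S.const q c) = S.const x c := by
  rw [← S.germ_constSection ⊤ q (TopologicalSpace.Opens.mem_top q),
    ← S.germ_constSection ⊤ x (TopologicalSpace.Opens.mem_top x)]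
  exact TopCat.Presheaf.germ_stalkSpecializes_apply _ _ _ _

lemma algebraMap_const (x : S.X) (c : ℂ) :
    algebraMap (S.O x) S.K (S.const x c) = algebraMap ℂ S.K c :=
  S.stalkSpecializes_const _ c

instance (x : S.X) : IsScalarTower ℂ (S.O x) S.K :=
  IsScalarTower.of_algebraMap_eq fun c => (S.algebraMap_const x c).symm

variable {S} in
lemma stalkMap_const {S' : SmoothProjectiveSurface} (p : S'.X ⟶ S.X) (hp : p ≫ S.str = S'.str)
    (x : S'.X) (c : ℂ) : p.stalkMap x (S.const (p x) c) = S'.const x c := by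
  rw [← S.germ_constSection ⊤ (p x) (TopologicalSpace.Opens.mem_top _),
    ← S'.germ_constSection ⊤ x (TopologicalSpace.Opens.mem_top x)]
  refine (Scheme.Hom.germ_stalkMap_apply p ⊤ x (TopologicalSpace.Opens.mem_top _) _).trans ?_
  have h : p.app ⊤ (S.constSection ⊤ c) = S'.constSection ⊤ c := by
    have e (T : SmoothProjectiveSurface) : T.constSection ⊤ =
        ((Scheme.ΓSpecIso (CommRingCat.of ℂ)).inv ≫ T.str.appTop).hom := by
      rw [constSection, Subsingleton.elim (homOfLE le_top : (⊤ : T.X.Opens) ⟶ ⊤) (𝟙 _), op_id,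
        CategoryTheory.Functor.map_id, Category.comp_id]
    rw [e, e, ← hp, Scheme.Hom.comp_appTop]
    rfl
  rw [h]
  rfl

/-- Every point of a smooth surface has an affine neighbourhood that is étale over the plane. -/
lemma exists_chart (x : S.X) : ∃ V : S.X.Opens, IsAffineOpen V ∧ x ∈ V ∧
    ∃ g : MvPolynomial (Fin 2) ℂ →+* Γ(S.X, V), g.comp MvPolynomial.C = S.constSection V ∧
      g.Etale := by
  obtain ⟨U, hU, V, hV, hxV, e, h⟩ :=
    SmoothOfRelativeDimension.exists_isStandardSmoothOfRelativeDimension (n := 2) (f := S.str) x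
  have hsub : Subsingleton (Spec (CommRingCat.of ℂ)) :=
    inferInstanceAs (Subsingleton (PrimeSpectrum ℂ))
  obtain rfl : U = ⊤ := by
    refine top_le_iff.mp fun y _ => ?_
    rw [Subsingleton.elim y (S.str x)]
    exact e hxV
  have h2 := (RingHom.isStandardSmoothOfRelativeDimension_respectsIso).2 _
    (Scheme.ΓSpecIso (CommRingCat.of ℂ)).symm.commRingCatIsoToRingEquiv h
  obtain ⟨g, hg, hg'⟩ := RingHom.IsStandardSmoothOfRelativeDimension.exists_etale_mvPolynomial h2
  exact ⟨V, hV, hxV, g, hg, hg'⟩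

/-- The maximal ideal of the local ring at a point of codimension one is principal, and the residue
field is not the field of constants. -/
lemma isPrincipal_maximalIdeal_of_coheight {x : S.X} (hx : Order.coheight x = 1) :
    (maximalIdeal (S.O x)).IsPrincipal ∧
      ∃ θ : S.O x, ∀ c : ℂ, θ - algebraMap ℂ (S.O x) c ∉ maximalIdeal (S.O x) := by
  obtain ⟨V, hV, hxV, g, hg, hge⟩ := S.exists_chart x
  algebraize [g]
  let := TopCat.Presheaf.algebra_section_stalk S.X.presheaf ⟨x, hxV⟩
  let q := (hV.primeIdealOf ⟨x, hxV⟩).asIdeal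
  have hloc : IsLocalization.AtPrime (S.O x) q := hV.isLocalization_stalk ⟨x, hxV⟩
  have hN : IsNoetherianRing Γ(S.X, V) :=
    Algebra.FiniteType.isNoetherianRing (MvPolynomial (Fin 2) ℂ) _
  have hq : q.height = 1 := by
    have h1 := IsLocalization.AtPrime.ringKrullDim_eq_height q (S.O x)
    rw [ringKrullDim_stalk_eq_coheight, hx] at h1
    exact (WithBot.coe_injective h1).symm
  have hP : (q.under (MvPolynomial (Fin 2) ℂ)).height ≤ 1 :=
    (Algebra.Etale.height_under_le q).trans hq.le
  have hPa := Ideal.exists_eq_span_singleton_of_height_le_one _ hP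
  obtain ⟨i, hi⟩ := MvPolynomial.exists_sub_C_notMem _ hPa
  have hmap := Algebra.Etale.map_under_eq_maximalIdeal (M := MvPolynomial (Fin 2) ℂ) q (S.O x)
  refine ⟨?_, algebraMap Γ(S.X, V) (S.O x) (g (MvPolynomial.X i)), fun c hc => hi c ?_⟩
  · obtain ⟨a, ha⟩ := hPa
    rw [← hmap, ha, Ideal.map_span, Set.image_singleton]
    infer_instance
  · have h1 : algebraMap ℂ (S.O x) c =
        algebraMap Γ(S.X, V) (S.O x) (g (MvPolynomial.C c)) := by
      rw [← RingHom.comp_apply g MvPolynomial.C, hg]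
      exact (S.germ_constSection V x hxV c).symm
    rw [h1, ← map_sub, ← map_sub, ← Ideal.mem_comap, ← Ideal.under_def,
      IsLocalization.AtPrime.under_maximalIdeal (S.O x) q] at hc
    exact hc

/-- The maximal ideal of the local ring at a point that is not closed is principal. -/
lemma isPrincipal_maximalIdeal_of_not_isClosed {x : S.X} (hx : ¬ IsClosed {x}) :
    (maximalIdeal (S.O x)).IsPrincipal := by
  obtain ⟨V, hV, hxV, g, hg, hge⟩ := S.exists_chart x
  algebraize [g]
  let := TopCat.Presheaf.algebra_section_stalk S.X.presheaf ⟨x, hxV⟩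
  let q := (hV.primeIdealOf ⟨x, hxV⟩).asIdeal
  have hloc : IsLocalization.AtPrime (S.O x) q := hV.isLocalization_stalk ⟨x, hxV⟩
  have hmap := Algebra.Etale.map_under_eq_maximalIdeal (M := MvPolynomial (Fin 2) ℂ) q (S.O x)
  have hP : ¬ (q.under (MvPolynomial (Fin 2) ℂ)).IsMaximal := by
    intro hmax
    have hq := Algebra.Etale.isMaximal_of_comap q hmax
    apply hx
    have : Smooth S.str := SmoothOfRelativeDimension.smooth 2 S.str
    have : JacobsonSpace S.X := LocallyOfFiniteType.jacobsonSpace S.str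
    have h1 := (PrimeSpectrum.isClosed_singleton_iff_isMaximal (hV.primeIdealOf ⟨x, hxV⟩)).mpr hq
    have h2 := h1.isLocallyClosed.image hV.fromSpec.isOpenEmbedding.isInducing
      hV.fromSpec.isOpenEmbedding.isOpen_range.isLocallyClosed
    have h3 : hV.fromSpec '' {hV.primeIdealOf ⟨x, hxV⟩} = {x} :=
      (Set.image_singleton).trans (by rw [hV.fromSpec_primeIdealOf])
    exact isClosed_singleton_of_isLocallyClosed_singleton ((congrArg IsLocallyClosed h3).mp h2)
  obtain ⟨a, ha⟩ := Ideal.exists_eq_span_singleton_of_height_le_one _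
    (MvPolynomial.height_le_one_of_not_isMaximal _ hP)
  rw [← hmap, ha, Ideal.map_span, Set.image_singleton]
  infer_instance

/-- Every point specializes to a point whose residue field is the field of constants. -/
lemma exists_specializes_residue (x : S.X) : ∃ q : S.X, x ⤳ q ∧
    ∀ a : S.O q, ∃ c : ℂ, a - algebraMap ℂ (S.O q) c ∈ maximalIdeal (S.O q) := by
  obtain ⟨V, hV, hxV, g, hg, hge⟩ := S.exists_chart x
  algebraize [g]
  let : Algebra ℂ Γ(S.X, V) := (S.constSection V).toAlgebra
  have : IsScalarTower ℂ (MvPolynomial (Fin 2) ℂ) Γ(S.X, V) :=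
    IsScalarTower.of_algebraMap_eq' hg.symm
  have hft : Algebra.FiniteType ℂ Γ(S.X, V) :=
    Algebra.FiniteType.trans (S := MvPolynomial (Fin 2) ℂ) inferInstance inferInstance
  obtain ⟨m, hm, hle⟩ := Ideal.exists_le_maximal (hV.primeIdealOf ⟨x, hxV⟩).asIdeal
    (Ideal.IsPrime.ne_top inferInstance)
  let y : PrimeSpectrum Γ(S.X, V) := ⟨m, hm.isPrime⟩
  have hy : hV.fromSpec y ∈ V := by
    have : hV.fromSpec y ∈ Set.range hV.fromSpec := ⟨y, rfl⟩
    rwa [hV.range_fromSpec] at this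
  refine ⟨hV.fromSpec y, ?_, fun a => ?_⟩
  · have h1 : hV.primeIdealOf ⟨x, hxV⟩ ⤳ y := (PrimeSpectrum.le_iff_specializes _ _).mp hle
    have h2 := h1.map hV.fromSpec.continuous
    rwa [hV.fromSpec_primeIdealOf] at h2
  · let := TopCat.Presheaf.algebra_section_stalk S.X.presheaf ⟨hV.fromSpec y, hy⟩
    have hloc : IsLocalization.AtPrime (S.O (hV.fromSpec y)) m := hV.isLocalization_stalk' y hy
    -- fractions are reduced to elements of the coordinate ring, whose residues are constants
    obtain ⟨b, s, rfl⟩ := IsLocalization.exists_mk'_eq m.primeCompl a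
    obtain ⟨c, hc⟩ := exists_sub_algebraMap_mem_of_isMaximal (k := ℂ) m hm b
    obtain ⟨d, hd⟩ := exists_sub_algebraMap_mem_of_isMaximal (k := ℂ) m hm (s : Γ(S.X, V))
    have hd0 : d ≠ 0 := by
      rintro rfl
      rw [map_zero, sub_zero] at hd
      exact s.2 hd
    have hconst : ∀ c : ℂ, algebraMap ℂ (S.O (hV.fromSpec y)) c =
        algebraMap Γ(S.X, V) (S.O (hV.fromSpec y)) (algebraMap ℂ Γ(S.X, V) c) := fun c =>
      (S.germ_constSection V _ hy c).symm
    refine ⟨c / d, ?_⟩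
    have hmem : b - algebraMap ℂ Γ(S.X, V) (c / d) * s ∈ m := by
      have h1 : b - algebraMap ℂ Γ(S.X, V) (c / d) * s = (b - algebraMap ℂ Γ(S.X, V) c) -
          algebraMap ℂ Γ(S.X, V) (c / d) * (s - algebraMap ℂ Γ(S.X, V) d) := by
        rw [mul_sub, ← map_mul, div_mul_cancel₀ _ hd0]
        ring
      rw [h1]
      exact sub_mem hc (Ideal.mul_mem_left _ _ hd)
    have h2 : IsLocalization.mk' (S.O (hV.fromSpec y)) b s -
        algebraMap ℂ (S.O (hV.fromSpec y)) (c / d) =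
        IsLocalization.mk' (S.O (hV.fromSpec y)) (b - algebraMap ℂ Γ(S.X, V) (c / d) * s) s := by
      rw [hconst, eq_comm, IsLocalization.mk'_eq_iff_eq_mul, sub_mul, IsLocalization.mk'_spec,
        map_sub, map_mul]
    rw [h2, IsLocalization.AtPrime.mk'_mem_maximal_iff (S.O (hV.fromSpec y)) m]
    exact hmem

end SmoothProjectiveSurface

/-! ### Function fields under generically finite morphisms -/

section GenericallyFinite

open IsLocalRing Polynomial

variable {X Y : Scheme.{0}} [IsIntegral X] [IsIntegral Y] (p : X ⟶ Y)

lemma functionFieldMap_germToFunctionField [IsDominant p] (W : Y.Opens) [Nonempty W]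
    [Nonempty (p ⁻¹ᵁ W)] (r : Γ(Y, W)) :
    functionFieldMap p (Y.germToFunctionField W r) =
      X.germToFunctionField (p ⁻¹ᵁ W) (p.app W r) := by
  obtain ⟨x, hx⟩ := ‹Nonempty (p ⁻¹ᵁ W)›
  have hx' : p x ∈ W := hx
  rw [← Scheme.algebraMap_germ_eq_germToFunctionField Y hx', functionFieldMap_algebraMap]
  refine (congrArg _ (Scheme.Hom.germ_stalkMap_apply p W x hx' r)).trans ?_
  exact Scheme.algebraMap_germ_eq_germToFunctionField X hx _

lemma stalkMap_injective_of_isDominant [IsDominant p] (x : X) :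
    Function.Injective (p.stalkMap x).hom := by
  intro a b hab
  apply IsFractionRing.injective (Y.presheaf.stalk (p x)) Y.functionField
  apply (functionFieldMap p).injective
  rw [functionFieldMap_algebraMap, functionFieldMap_algebraMap]
  exact congrArg _ hab

lemma CommRingCat.isIntegral_of_comp_retract {A B C : CommRingCat.{0}} (f : A ⟶ B) (e : B ⟶ C)
    (e' : C ⟶ B) (he : e ≫ e' = 𝟙 B) (h : (f ≫ e).hom.IsIntegral) : f.hom.IsIntegral := by
  intro b
  obtain ⟨P, hP, hPb⟩ := h (e b)
  refine ⟨P, hP, ?_⟩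
  have h1 := congrArg e'.hom hPb
  rw [map_zero, hom_eval₂, ← CommRingCat.hom_comp, Category.assoc, he, Category.comp_id] at h1
  have h2 : e'.hom (e b) = b := congrArg (fun g => g.hom b) he
  rwa [h2] at h1

/-- The function field extension of a generically finite morphism is algebraic. -/
lemma exists_eval₂_functionFieldMap_eq_zero [IsGenericallyFinite p] (a : X.functionField) :
    ∃ Q : Y.functionField[X], Q ≠ 0 ∧ Q.eval₂ (functionFieldMap p) a = 0 := by
  obtain ⟨V, ⟨y, hyV⟩, hfin⟩ := IsGenericallyFinite.finite (p := p)
  -- an affine open subset of the target over which the morphism is finite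
  obtain ⟨U, hU, hyU, -⟩ := exists_isAffineOpen_mem_and_subset (X := V.toScheme) (x := ⟨y, hyV⟩)
    (U := ⊤) trivial
  let W : Y.Opens := V.ι ''ᵁ U
  have hW : IsAffineOpen (p ⁻¹ᵁ W) := by
    have h1 : IsAffineOpen ((p ∣_ V) ⁻¹ᵁ U) := hU.preimage (p ∣_ V)
    have h2 := h1.image_of_isOpenImmersion (p ⁻¹ᵁ V).ι
    rwa [image_morphismRestrict_preimage] at h2
  have : Nonempty W := ⟨⟨_, Set.mem_image_of_mem _ hyU⟩⟩
  have : Nonempty (p ⁻¹ᵁ W) := by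
    obtain ⟨_, hz, x, rfl⟩ := p.denseRange.inter_open_nonempty W W.isOpen
      ⟨_, Set.mem_image_of_mem _ hyU⟩
    exact ⟨⟨x, hz⟩⟩
  have hint : (p.app W).hom.IsIntegral := by
    have h1 := (IsFinite.finite_app (f := p ∣_ V) U hU).to_isIntegral
    rw [morphismRestrict_app] at h1
    refine CommRingCat.isIntegral_of_comp_retract _ _
      (X.presheaf.map (eqToHom (image_morphismRestrict_preimage p V U).symm).op) ?_ h1
    rw [← Functor.map_comp, Subsingleton.elim
      ((eqToHom (image_morphismRestrict_preimage p V U)).op ≫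
      (eqToHom (image_morphismRestrict_preimage p V U).symm).op) (𝟙 _)]
    exact CategoryTheory.Functor.map_id _ _
  let : Algebra Y.functionField X.functionField := (functionFieldMap p).toAlgebra
  have halg : ∀ b : Γ(X, p ⁻¹ᵁ W),
      IsIntegral Y.functionField (X.germToFunctionField (p ⁻¹ᵁ W) b) := by
    intro b
    obtain ⟨P, hP, hPb⟩ := hint b
    refine ⟨P.map (Y.germToFunctionField W).hom, hP.map _, ?_⟩
    have h1 := congrArg (X.germToFunctionField (p ⁻¹ᵁ W)).hom hPb
    rw [map_zero, hom_eval₂] at h1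
    rw [eval₂_map, ← h1]
    congr 1
    ext r
    exact functionFieldMap_germToFunctionField p W r
  have := functionField_isFractionRing_of_isAffineOpen X (p ⁻¹ᵁ W) hW
  obtain ⟨b, c, hc, rfl⟩ := IsFractionRing.div_surjective (A := Γ(X, p ⁻¹ᵁ W)) a
  have h1 : IsAlgebraic Y.functionField
      (algebraMap Γ(X, p ⁻¹ᵁ W) X.functionField b /
        algebraMap Γ(X, p ⁻¹ᵁ W) X.functionField c) := by
    rw [div_eq_mul_inv]
    exact (halg b).isAlgebraic.mul (halg c).isAlgebraic.inv
  exact h1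

lemma exists_eval₂_stalkMap_eq_zero [IsGenericallyFinite p] (x : X) (g : X.presheaf.stalk x) :
    ∃ Q : (Y.presheaf.stalk (p x))[X], Q ≠ 0 ∧ Q.eval₂ (p.stalkMap x).hom g = 0 := by
  let : Algebra Y.functionField X.functionField := (functionFieldMap p).toAlgebra
  let : Algebra (Y.presheaf.stalk (p x)) X.functionField :=
    ((functionFieldMap p).comp (algebraMap _ _)).toAlgebra
  have : IsScalarTower (Y.presheaf.stalk (p x)) Y.functionField X.functionField :=
    IsScalarTower.of_algebraMap_eq' rfl
  have h1 : IsAlgebraic Y.functionField (algebraMap (X.presheaf.stalk x) X.functionField g) :=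
    exists_eval₂_functionFieldMap_eq_zero p _
  obtain ⟨Q, hQ, hQg⟩ := (IsFractionRing.isAlgebraic_iff (Y.presheaf.stalk (p x)) Y.functionField
    X.functionField).mpr h1
  refine ⟨Q, hQ, ?_⟩
  apply IsFractionRing.injective (X.presheaf.stalk x) X.functionField
  rw [map_zero, hom_eval₂, ← hQg, aeval_def]
  congr 1
  ext a
  exact (functionFieldMap_algebraMap p x a).symm

/-- A derivation of the function field is determined by its values on a subfield over which the
function field is algebraic. -/
lemma Derivation.eq_zero_of_functionFieldMap [IsGenericallyFinite p] {R : Type*} [Field R]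
    [CharZero R] [Algebra R X.functionField] (w : Derivation R X.functionField X.functionField)
    (hw : ∀ b, w (functionFieldMap p b) = 0) : w = 0 := by
  ext a
  let : Algebra Y.functionField X.functionField := (functionFieldMap p).toAlgebra
  have : CharZero X.functionField := charZero_of_injective_algebraMap (algebraMap R _).injective
  have : CharZero Y.functionField := (functionFieldMap p).charZero
  have hint : IsIntegral Y.functionField a :=
    IsAlgebraic.isIntegral (exists_eval₂_functionFieldMap_eq_zero p a)
  have h1 := w.eval₂_sub_mem (functionFieldMap p) ⊥ (fun c => by simp [hw]) a
    (minpoly Y.functionField a)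
  have h2 : (minpoly Y.functionField a).eval₂ (functionFieldMap p) a = 0 := minpoly.aeval _ _
  rw [h2, map_zero, zero_sub, neg_mem_iff, Ideal.mem_bot] at h1
  exact (mul_eq_zero.mp h1).resolve_left
    ((minpoly.irreducible hint).separable.aeval_derivative_ne_zero (minpoly.aeval _ _))

end GenericallyFinite

/-! ### Orders of vanishing in discrete valuation rings -/

section Ord

variable {X : Scheme.{0}} [IsIntegral X] [IsLocallyNoetherian X]

lemma ord_eq_zero_of_mem_localUnits {x : X} {u : (X.functionField)ˣ} (hu : u ∈ localUnits X x) :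
    Scheme.ord (u : X.functionField) x = 0 :=
  congrArg Multiplicative.toAdd (localUnits_le_ker_ordAt x hu)

lemma ord_units_mul (x : X) (f g : (X.functionField)ˣ) :
    Scheme.ord ((f * g : (X.functionField)ˣ) : X.functionField) x =
      Scheme.ord (f : X.functionField) x + Scheme.ord (g : X.functionField) x :=
  Scheme.ord_mul f.ne_zero g.ne_zero

lemma ord_units_inv (x : X) (f : (X.functionField)ˣ) :
    Scheme.ord ((f⁻¹ : (X.functionField)ˣ) : X.functionField) x =
      - Scheme.ord (f : X.functionField) x :=
  congrArg Multiplicative.toAdd (map_inv (ordAt x) f)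

lemma ord_algebraMap_of_associated_pow {x : X} [IsDiscreteValuationRing (X.presheaf.stalk x)]
    (hx : Order.coheight x = 1) {t : X.presheaf.stalk x} (ht : Irreducible t)
    {α : X.presheaf.stalk x} {n : ℕ} (h : Associated (t ^ n) α) :
    Scheme.ord (algebraMap (X.presheaf.stalk x) X.functionField α) x = n := by
  have : Ring.KrullDimLE 1 (X.presheaf.stalk x) := krullDimLE_of_coheight_le hx.le
  obtain ⟨u, rfl⟩ := h
  have h1 : Scheme.ordHom x hx (algebraMap (X.presheaf.stalk x) X.functionField u) = 1 :=
    Ring.ordFrac_of_isUnit u.isUnit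
  have h2 : Scheme.ordHom x hx (algebraMap (X.presheaf.stalk x) X.functionField t) =
      WithZero.exp 1 := Ring.ordFrac_irreducible ht
  rw [Scheme.ord_eq_iff hx ((map_ne_zero_iff _ (IsFractionRing.injective _ _)).mpr
    (mul_ne_zero (pow_ne_zero _ ht.ne_zero) u.ne_zero)), map_mul, map_mul, map_pow, map_pow, h1, h2,
    mul_one, ← WithZero.exp_nsmul]
  simp [WithZero.exp_eq_coe_ofAdd]

end Ord

/-! ### Rational vector fields and foliations at a point -/

namespace SmoothProjectiveSurface

open IsLocalRing

variable {S : SmoothProjectiveSurface}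

/-- A rational vector field that is regular at `x` restricts to a derivation of the local ring. -/
lemma exists_derivation_of_mem_tangent {x : S.X} {w : S.RatVectorField} (hw : w ∈ S.tangent x) :
    ∃ w' : Derivation ℂ (S.O x) (S.O x), ∀ a,
      algebraMap (S.O x) S.K (w' a) = w (algebraMap (S.O x) S.K a) := by
  choose f hf using hw
  have hinj := IsFractionRing.injective (S.O x) S.K
  refine ⟨Derivation.mk' ⟨⟨f, fun a b => hinj ?_⟩, fun c a => hinj ?_⟩ fun a b => hinj ?_,
    fun a => (hf a).symm⟩
  · simp only [map_add, ← hf]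
  · change algebraMap (S.O x) S.K (f (c • a)) = algebraMap (S.O x) S.K (c • f a)
    have hc : ∀ b, algebraMap (S.O x) S.K (c • b) = c • algebraMap (S.O x) S.K b := fun b => by
      rw [Algebra.smul_def, Algebra.smul_def, map_mul, ← IsScalarTower.algebraMap_apply]
    rw [← hf, hc, hc, Derivation.map_smul, hf]
  · change algebraMap (S.O x) S.K (f (a * b)) = algebraMap (S.O x) S.K (a * f b + b * f a)
    rw [← hf, map_mul, Derivation.leibniz, map_add, map_mul, map_mul, hf, hf]
    rfl

lemma algebraMap_stalkSpecializes {x q : S.X} (h : x ⤳ q) (a : S.O q) :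
    algebraMap (S.O x) S.K (S.X.presheaf.stalkSpecializes h a) = algebraMap (S.O q) S.K a :=
  congrArg (fun f => f.hom a) (TopCat.Presheaf.stalkSpecializes_comp S.X.presheaf
    ((genericPoint_spec S.X).specializes trivial) h)

/-- A vector field that is regular at a point is regular at all points specializing to it. -/
lemma tangent_of_specializes {x q : S.X} (h : x ⤳ q) {v : S.RatVectorField}
    (hv : v ∈ S.tangent q) : v ∈ S.tangent x := by
  intro a
  obtain ⟨_, ⟨V, hV, rfl⟩, hqV, -⟩ := S.X.isBasis_affineOpens.exists_subset_of_mem_open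
    (Set.mem_univ q) isOpen_univ
  have hxV : x ∈ V := h.mem_open V.isOpen hqV
  let := TopCat.Presheaf.algebra_section_stalk S.X.presheaf ⟨x, hxV⟩
  have hloc : IsLocalization.AtPrime (S.O x) (hV.primeIdealOf ⟨x, hxV⟩).asIdeal :=
    hV.isLocalization_stalk ⟨x, hxV⟩
  obtain ⟨⟨b, s⟩, hbs⟩ := IsLocalization.surj (hV.primeIdealOf ⟨x, hxV⟩).asIdeal.primeCompl a
  have hs : IsUnit (algebraMap Γ(S.X, V) (S.O x) s) := IsLocalization.map_units _ s
  obtain ⟨s', hs'⟩ := hs.exists_left_inv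
  have hreg : ∀ r : Γ(S.X, V), ∃ c : S.O x,
      v (algebraMap (S.O x) S.K (algebraMap Γ(S.X, V) (S.O x) r)) = algebraMap (S.O x) S.K c := by
    intro r
    obtain ⟨c, hc⟩ := hv (S.X.presheaf.germ V q hqV r)
    refine ⟨S.X.presheaf.stalkSpecializes h c, ?_⟩
    rw [algebraMap_stalkSpecializes, ← hc, ← algebraMap_stalkSpecializes h]
    exact congrArg (fun z => v (algebraMap (S.O x) S.K z))
      (TopCat.Presheaf.germ_stalkSpecializes_apply S.X.presheaf hqV h r).symm
  obtain ⟨c, hc⟩ := hreg b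
  obtain ⟨d, hd⟩ := hreg s
  refine ⟨s' * (c - a * d), ?_⟩
  have h1 := congrArg (fun z => v (algebraMap (S.O x) S.K z)) hbs
  simp only [map_mul, Derivation.leibniz, smul_eq_mul] at h1
  rw [hc, hd] at h1
  have h2 := congrArg (algebraMap (S.O x) S.K) hs'
  rw [map_mul, map_one] at h2
  rw [map_mul, map_sub, map_mul, ← h1]
  linear_combination (-v (algebraMap (S.O x) S.K a)) * h2

end SmoothProjectiveSurface

namespace Foliation

open IsLocalRing

variable {S : SmoothProjectiveSurface} (F : Foliation S)

lemma exists_generator (x : S.X) : ∃ v, v ≠ 0 ∧ F.T x = Submodule.span (S.O x) {v} := by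
  obtain ⟨U, hxU, v, hv, h⟩ := F.invertible x
  exact ⟨v, hv, h x hxU⟩

lemma generator_ne_zero {x : S.X} {v : S.RatVectorField}
    (h : F.T x = Submodule.span (S.O x) {v}) : v ≠ 0 := by
  obtain ⟨w, hw, hw'⟩ := F.exists_generator x
  rintro rfl
  apply hw
  have h1 : w ∈ F.T x := hw' ▸ Submodule.mem_span_singleton_self w
  rwa [h, Submodule.span_zero_singleton, Submodule.mem_bot] at h1

/-- A generator of a saturated subsheaf does not vanish along a divisor. -/
lemma exists_isUnit_of_generator {x : S.X} {t : S.O x} (ht : t ≠ 0) (htu : ¬ IsUnit t)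
    (htm : maximalIdeal (S.O x) = Ideal.span {t}) {v : S.RatVectorField}
    (hv : F.T x = Submodule.span (S.O x) {v}) (v' : Derivation ℂ (S.O x) (S.O x))
    (hv' : ∀ a, algebraMap (S.O x) S.K (v' a) = v (algebraMap (S.O x) S.K a)) :
    ∃ g, IsUnit (v' g) := by
  by_contra! hcon
  have hne : algebraMap (S.O x) S.K t ≠ 0 :=
    (map_ne_zero_iff _ (IsFractionRing.injective _ _)).mpr ht
  have hmem : (algebraMap (S.O x) S.K t)⁻¹ • v ∈ S.tangent x := by
    intro a
    have h1 : v' a ∈ maximalIdeal (S.O x) := (mem_maximalIdeal _).mpr (hcon a)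
    rw [htm, Ideal.mem_span_singleton] at h1
    obtain ⟨b, hb⟩ := h1
    refine ⟨b, ?_⟩
    rw [Derivation.smul_apply, ← hv', hb, map_mul, smul_eq_mul, inv_mul_cancel_left₀ hne]
  have hsat := F.saturated x _ hmem t ht (by
    rw [smul_eq_algebraMap_smul, smul_smul, mul_inv_cancel₀ hne, one_smul, hv]
    exact Submodule.mem_span_singleton_self v)
  rw [hv] at hsat
  obtain ⟨a, ha⟩ := Submodule.mem_span_singleton.mp hsat
  rw [smul_eq_algebraMap_smul] at ha
  have h2 := smul_left_injective S.K (F.generator_ne_zero hv) ha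
  apply htu
  refine IsUnit.of_mul_eq_one a (IsFractionRing.injective (S.O x) S.K ?_)
  rw [map_mul, map_one, h2, mul_inv_cancel₀ hne]

variable {F} {S' : SmoothProjectiveSurface} {p : S'.X ⟶ S.X} {F' : Foliation S'}

/-- A vector field defining the pull-back foliation is a multiple of one defining the foliation. -/
lemma IsPullback.exists_relation [IsDominant p] (hF : F.IsPullback p F') {v : S.RatVectorField}
    (hv0 : v ≠ 0) (hv : ∀ y, ∀ v' ∈ F.T y, ∃ c : S.K, v' = c • v) {x : S'.X}
    {w : S'.RatVectorField} (hw : w ∈ F'.T x) :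
    ∃ h : S'.K, ∀ b, w (functionFieldMap p b) = h * functionFieldMap p (v b) := by
  obtain ⟨b₀, hb₀⟩ : ∃ b, v b ≠ 0 := by
    by_contra! h
    exact hv0 (Derivation.ext h)
  have hb₀' : functionFieldMap p (v b₀) ≠ 0 := (map_ne_zero _).mpr hb₀
  refine ⟨w (functionFieldMap p b₀) / functionFieldMap p (v b₀), fun b => ?_⟩
  have h1 := ((hF x w).mp hw).2 2 ![1, -(v b / v b₀)] ![b, b₀] (by
    intro y v' hv'
    obtain ⟨c, rfl⟩ := hv y v' hv'
    simp only [Fin.sum_univ_two, Matrix.cons_val_zero, Matrix.cons_val_one, Derivation.smul_apply,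
      smul_eq_mul]
    field_simp
    ring)
  simp only [Fin.sum_univ_two, Matrix.cons_val_zero, Matrix.cons_val_one, map_one, map_neg,
    map_div₀, one_mul] at h1
  rw [add_eq_zero_iff_eq_neg.mp h1]
  field_simp

/-- Vector fields defining the pull-back foliation at a point also do so at its generizations. -/
lemma IsPullback.mem_of_specializes [IsDominant p] (hF : F.IsPullback p F') {x q : S'.X}
    (h : x ⤳ q) {w : S'.RatVectorField} (hw : w ∈ F'.T q) : w ∈ F'.T x :=
  (hF x w).mpr ⟨SmoothProjectiveSurface.tangent_of_specializes h ((hF q w).mp hw).1,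
    ((hF q w).mp hw).2⟩

/-- Invariance of a curve may be tested at its generic point, on a local equation `t`. -/
lemma IsPullback.isInvariant_iff [IsDominant p] (hF : F.IsPullback p F') {x : S'.X}
    {t : S'.O x} (htm : maximalIdeal (S'.O x) = Ideal.span {t}) {w : S'.RatVectorField}
    (hw : F'.T x = Submodule.span (S'.O x) {w}) (w' : Derivation ℂ (S'.O x) (S'.O x))
    (hw' : ∀ a, algebraMap (S'.O x) S'.K (w' a) = w (algebraMap (S'.O x) S'.K a)) :
    F'.IsInvariant x ↔ w' t ∈ maximalIdeal (S'.O x) := by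
  have hinj := IsFractionRing.injective (S'.O x) S'.K
  have ht : t ∈ maximalIdeal (S'.O x) := htm ▸ Ideal.mem_span_singleton_self t
  have hrefl : ∀ a : S'.O x, (S'.X.presheaf.stalkSpecializes (specializes_refl x)).hom a = a := by
    intro a
    apply hinj
    exact SmoothProjectiveSurface.algebraMap_stalkSpecializes (specializes_refl x) a
  constructor
  · intro h
    obtain ⟨b, hb, hb'⟩ := h x (specializes_refl x) w
      (hw ▸ Submodule.mem_span_singleton_self w) t (by rw [Ideal.mem_comap, hrefl]; exact ht)
    rw [Ideal.mem_comap, hrefl] at hb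
    rw [← hw'] at hb'
    rwa [hinj hb']
  · intro h q hxq v hv a ha
    obtain ⟨b, hb⟩ := F'.le_tangent q hv a
    refine ⟨b, ?_, hb⟩
    have hvx := hF.mem_of_specializes hxq hv
    rw [hw] at hvx
    obtain ⟨c, rfl⟩ := Submodule.mem_span_singleton.mp hvx
    rw [Ideal.mem_comap, htm, Ideal.mem_span_singleton] at ha
    obtain ⟨d, hd⟩ := ha
    have h1 : (S'.X.presheaf.stalkSpecializes hxq).hom b = c * w' (t * d) := by
      apply hinj
      rw [map_mul, hw', ← hd]
      refine (SmoothProjectiveSurface.algebraMap_stalkSpecializes hxq b).trans (hb.symm.trans ?_)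
      rw [← SmoothProjectiveSurface.algebraMap_stalkSpecializes hxq a, smul_eq_algebraMap_smul]
      rfl
    rw [Ideal.mem_comap, h1, Derivation.leibniz, smul_eq_mul, smul_eq_mul]
    exact Ideal.mul_mem_left _ _ (add_mem (Ideal.mul_mem_right _ _ ht) (Ideal.mul_mem_left _ _ h))

end Foliation

/-! ### The discrepancy along a prime divisor -/

section Discrepancy

open IsLocalRing Polynomial

variable {S S' : SmoothProjectiveSurface} {p : S'.X ⟶ S.X}

lemma SmoothProjectiveSurface.isDiscreteValuationRing_of_coheight {x : S.X}
    (hx : Order.coheight x = 1) : IsDiscreteValuationRing (S.O x) := by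
  have hf : ¬ IsField (S.O x) := fun h => by
    have h1 := ringKrullDim_eq_zero_of_isField h
    rw [ringKrullDim_stalk_eq_coheight, hx] at h1
    exact absurd h1 (by decide)
  exact ((IsDiscreteValuationRing.TFAE (S.O x) hf).out 0 4).mpr
    (S.isPrincipal_maximalIdeal_of_coheight hx).1

/-- The homomorphism of local rings, as a homomorphism of `ℂ`-algebras. -/
def stalkAlgHom (p : S'.X ⟶ S.X) (hp : p ≫ S.str = S'.str) (x : S'.X) :
    S.O (p x) →ₐ[ℂ] S'.O x :=
  { (p.stalkMap x).hom with commutes' := fun c => SmoothProjectiveSurface.stalkMap_const p hp x c }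

instance (hp : p ≫ S.str = S'.str) (x : S'.X) :
    IsLocalHom (stalkAlgHom p hp x : S.O (p x) →+* S'.O x) :=
  inferInstanceAs (IsLocalHom (p.stalkMap x).hom)

lemma stalkAlgHom_injective [IsDominant p] (hp : p ≫ S.str = S'.str) (x : S'.X) :
    Function.Injective (stalkAlgHom p hp x) :=
  stalkMap_injective_of_isDominant p x

lemma exists_eval₂_stalkAlgHom_eq_zero [IsGenericallyFinite p] (hp : p ≫ S.str = S'.str) (x : S'.X)
    (g : S'.O x) :
    ∃ Q : (S.O (p x))[X], Q ≠ 0 ∧ Q.eval₂ (stalkAlgHom p hp x : S.O (p x) →+* S'.O x) g = 0 :=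
  exists_eval₂_stalkMap_eq_zero p x g

/-- The local ring at the image of a curve that is not contracted is a discrete valuation ring. -/
lemma isDiscreteValuationRing_of_not_isContracted [IsGenericallyFinite p]
    (hp : p ≫ S.str = S'.str) {x : S'.X} (hx : Order.coheight x = 1) (hc : ¬ IsContracted p x) :
    IsDiscreteValuationRing (S.O (p x)) := by
  have hcl : ¬ IsClosed {p x} := by
    intro h
    apply hc
    have h1 : p '' closure {x} ⊆ {p x} := by
      refine (image_closure_subset_closure_image p.continuous).trans ?_
      rw [Set.image_singleton, h.closure_eq]
    exact Set.subsingleton_singleton.anti h1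
  have := S'.isDiscreteValuationRing_of_coheight hx
  -- a local ring that is algebraic over a field would be a field
  have hf : ¬ IsField (S.O (p x)) := by
    intro h
    let := h.toField
    let : Algebra (S.O (p x)) (S'.O x) := (stalkAlgHom p hp x : S.O (p x) →+* S'.O x).toAlgebra
    have hint : Algebra.IsIntegral (S.O (p x)) (S'.O x) :=
      ⟨fun g => IsAlgebraic.isIntegral (exists_eval₂_stalkAlgHom_eq_zero hp x g)⟩
    exact IsDiscreteValuationRing.not_isField (S'.O x) (isField_of_isIntegral_of_isField' h)
  exact ((IsDiscreteValuationRing.TFAE (S.O (p x)) hf).out 0 4).mpr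
    (S.isPrincipal_maximalIdeal_of_not_isClosed hcl)

/-- The residue field at the image of a contracted curve is the field of constants. -/
lemma exists_sub_algebraMap_mem_of_isContracted (hp : p ≫ S.str = S'.str) {x : S'.X}
    (hc : IsContracted p x) (a : S.O (p x)) :
    ∃ c : ℂ, a - algebraMap ℂ (S.O (p x)) c ∈ maximalIdeal (S.O (p x)) := by
  obtain ⟨q, hxq, hq⟩ := S'.exists_specializes_residue x
  have hpq : p q = p x := hc ⟨q, specializes_iff_mem_closure.mp hxq, rfl⟩
    ⟨x, subset_closure rfl, rfl⟩
  have key : ∀ a : S.O (p q), ∃ c : ℂ,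
      a - algebraMap ℂ (S.O (p q)) c ∈ maximalIdeal (S.O (p q)) := by
    intro a
    obtain ⟨c, hc⟩ := hq (stalkAlgHom p hp q a)
    refine ⟨c, (mem_maximalIdeal _).mpr fun h => (mem_maximalIdeal _).mp hc ?_⟩
    have h1 := h.map (stalkAlgHom p hp q)
    rwa [map_sub, AlgHom.commutes] at h1
  rw [hpq] at key
  exact key a

/-- The relation between vector fields, on the local rings. -/
lemma algebraMap_derivation_stalkAlgHom [IsDominant p] (hp : p ≫ S.str = S'.str) {x : S'.X}
    {v : S.RatVectorField} {w : S'.RatVectorField} {h : S'.K}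
    (hwv : ∀ b, w (functionFieldMap p b) = h * functionFieldMap p (v b))
    {v' : Derivation ℂ (S.O (p x)) (S.O (p x))} {w' : Derivation ℂ (S'.O x) (S'.O x)}
    (hv' : ∀ a, algebraMap (S.O (p x)) S.K (v' a) = v (algebraMap (S.O (p x)) S.K a))
    (hw' : ∀ a, algebraMap (S'.O x) S'.K (w' a) = w (algebraMap (S'.O x) S'.K a))
    (b : S.O (p x)) :
    algebraMap (S'.O x) S'.K (w' (stalkAlgHom p hp x b)) =
      h * algebraMap (S'.O x) S'.K (stalkAlgHom p hp x (v' b)) := by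
  have h1 : ∀ a, algebraMap (S'.O x) S'.K (stalkAlgHom p hp x a) =
      functionFieldMap p (algebraMap (S.O (p x)) S.K a) :=
    fun a => (functionFieldMap_algebraMap p x a).symm
  rw [hw', h1, h1, hwv, hv']

lemma ramificationIndex_eq {x : S'.X} [IsDiscreteValuationRing (S.O (p x))]
    [IsDiscreteValuationRing (S'.O x)] {s : S.O (p x)} (hs : Irreducible s) {t : S'.O x}
    (ht : Irreducible t) {u : S'.O x} (hu : IsUnit u) {e : ℕ}
    (hst : (p.stalkMap x).hom s = u * t ^ e) : ramificationIndex p x = e := by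
  have h1 : {n : ℕ | (maximalIdeal (S.X.presheaf.stalk (p x))).map (p.stalkMap x).hom ≤
      maximalIdeal (S'.X.presheaf.stalk x) ^ n} = Set.Iic e := by
    ext n
    rw [Set.mem_ofPred_eq, hs.maximalIdeal_eq, ht.maximalIdeal_eq, Ideal.map_span,
      Set.image_singleton, Ideal.span_singleton_pow, Ideal.span_singleton_le_span_singleton, hst,
      hu.dvd_mul_left, pow_dvd_pow_iff ht.ne_zero ht.not_isUnit]
    rfl
  rw [ramificationIndex, h1]
  exact csSup_Iic

variable {F : Foliation S} {F' : Foliation S'}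

/-- Along a curve that is not contracted, the discrepancy is the ramification index minus one if
the curve is not invariant, and zero otherwise. -/
theorem ord_eq_ramificationMult [IsGenericallyFinite p] (hp : p ≫ S.str = S'.str)
    (hF : F.IsPullback p F') {x : S'.X} (hx : Order.coheight x = 1) (hc : ¬ IsContracted p x)
    {v : S.RatVectorField} (hv : F.T (p x) = Submodule.span (S.O (p x)) {v})
    {w : S'.RatVectorField} (hw : F'.T x = Submodule.span (S'.O x) {w})
    (h : (S'.K)ˣ) (hwv : ∀ b, w (functionFieldMap p b) = h * functionFieldMap p (v b)) :
    Scheme.ord (h : S'.X.functionField) x = F'.ramificationMult p x := by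
  have hD' := S'.isDiscreteValuationRing_of_coheight hx
  have hD := isDiscreteValuationRing_of_not_isContracted hp hx hc
  have hinj := IsFractionRing.injective (S'.O x) S'.K
  have : CharZero (ResidueField (S.O (p x))) := charZero_of_injective_algebraMap
    (algebraMap ℂ (ResidueField (S.O (p x)))).injective
  obtain ⟨v', hv'⟩ := SmoothProjectiveSurface.exists_derivation_of_mem_tangent
    (F.le_tangent _ (hv ▸ Submodule.mem_span_singleton_self v))
  obtain ⟨w', hw'⟩ := SmoothProjectiveSurface.exists_derivation_of_mem_tangent
    (F'.le_tangent _ (hw ▸ Submodule.mem_span_singleton_self w))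
  have hrel := algebraMap_derivation_stalkAlgHom hp hwv hv' hw'
  have hφ := stalkAlgHom_injective hp x
  obtain ⟨t, ht⟩ := IsDiscreteValuationRing.exists_irreducible (S'.O x)
  obtain ⟨s, hs⟩ := IsDiscreteValuationRing.exists_irreducible (S.O (p x))
  have hw1 := F'.exists_isUnit_of_generator ht.ne_zero ht.not_isUnit ht.maximalIdeal_eq hw w' hw'
  have hv1 := F.exists_isUnit_of_generator hs.ne_zero hs.not_isUnit hs.maximalIdeal_eq hv v' hv'
  have hinv := hF.isInvariant_iff ht.maximalIdeal_eq hw w' hw'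
  obtain ⟨e, u, hst⟩ := IsDiscreteValuationRing.eq_unit_mul_pow_irreducible
    ((map_ne_zero_iff _ hφ).mpr hs.ne_zero) ht
  have he : e ≠ 0 := by
    rintro rfl
    rw [pow_zero, mul_one] at hst
    refine hs.not_isUnit (isUnit_of_map_unit (stalkAlgHom p hp x : S.O (p x) →+* S'.O x) s ?_)
    change IsUnit (stalkAlgHom p hp x s)
    rw [hst]
    exact u.isUnit
  have hram : ramificationIndex p x = e := ramificationIndex_eq hs ht u.isUnit hst
  -- the multiple `h` is regular, since `v` does not vanish along the image curve
  obtain ⟨α, hα⟩ : ∃ α : S'.O x, algebraMap (S'.O x) S'.K α = h := by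
    rcases ValuationRing.isInteger_or_isInteger (S'.O x) (h : S'.K) with ⟨α, hα⟩ | ⟨α, hα⟩
    · exact ⟨α, hα⟩
    · obtain ⟨g, hg⟩ := hv1
      have h1 : α * w' (stalkAlgHom p hp x g) = stalkAlgHom p hp x (v' g) := by
        apply hinj
        rw [map_mul, hrel, hα, inv_mul_cancel_left₀ h.ne_zero]
      obtain ⟨u, rfl⟩ := isUnit_of_mul_isUnit_left (h1 ▸ hg.map (stalkAlgHom p hp x))
      refine ⟨(u⁻¹ : (S'.O x)ˣ), ?_⟩
      have h2 : algebraMap (S'.O x) S'.K (u : S'.O x) * h = 1 := by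
        rw [hα, inv_mul_cancel₀ h.ne_zero]
      have h3 : algebraMap (S'.O x) S'.K (u : S'.O x) *
          algebraMap (S'.O x) S'.K (u⁻¹ : (S'.O x)ˣ) = 1 := by
        rw [← map_mul, Units.mul_inv, map_one]
      exact mul_left_cancel₀ ((map_ne_zero_iff _ hinj).mpr u.ne_zero) (h3.trans h2.symm)
  have key := Derivation.multiple_of_ramified (stalkAlgHom p hp x : S.O (p x) →+* S'.O x) hφ
    (exists_eval₂_stalkAlgHom_eq_zero hp x) w' v' α (fun b => hinj (by
      rw [map_mul, hα]; exact hrel b)) hw1 hs ht he u.isUnit hst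
  rw [← hα, Foliation.ramificationMult, hram]
  by_cases hi : F'.IsInvariant x
  · rw [if_neg (by tauto)]
    obtain ⟨u, rfl⟩ := key.1 (hinv.mp hi)
    exact ord_algebraMap_of_associated_pow (n := 0) hx ht ⟨u, by simp⟩
  · rw [if_pos ⟨hx, hc, hi⟩, ord_algebraMap_of_associated_pow hx ht
      (key.2 (fun h => hi (hinv.mpr h))).symm]
    omega

/-- Along a contracted curve, the discrepancy is not negative if the foliation is reduced, whether
the image point is singular or not. -/
theorem ord_nonneg_of_isReduced [IsGenericallyFinite p] (hp : p ≫ S.str = S'.str)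
    (hred : F.IsReduced) {x : S'.X} (hx : Order.coheight x = 1)
    (hc : IsContracted p x) {v : S.RatVectorField}
    (hv : F.T (p x) = Submodule.span (S.O (p x)) {v})
    {w : S'.RatVectorField} (hw : F'.T x = Submodule.span (S'.O x) {w})
    (h : (S'.K)ˣ) (hwv : ∀ b, w (functionFieldMap p b) = h * functionFieldMap p (v b)) :
    0 ≤ Scheme.ord (h : S'.X.functionField) x := by
  have hD' := S'.isDiscreteValuationRing_of_coheight hx
  have hinj := IsFractionRing.injective (S'.O x) S'.K
  obtain ⟨w', hw'⟩ := SmoothProjectiveSurface.exists_derivation_of_mem_tangent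
    (F'.le_tangent _ (hw ▸ Submodule.mem_span_singleton_self w))
  obtain ⟨t, ht⟩ := IsDiscreteValuationRing.exists_irreducible (S'.O x)
  have hφ := stalkAlgHom_injective hp x
  have hint : ∀ α : S'.O x, algebraMap (S'.O x) S'.K α = h →
      0 ≤ Scheme.ord (h : S'.X.functionField) x := by
    intro α hα
    have hα0 : α ≠ 0 := by
      rintro rfl
      exact h.ne_zero (by rw [← hα, map_zero])
    obtain ⟨n, u, hn⟩ := IsDiscreteValuationRing.eq_unit_mul_pow_irreducible hα0 ht
    rw [← hα, ord_algebraMap_of_associated_pow hx ht (n := n) ⟨u, by rw [hn, mul_comm]⟩]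
    positivity
  rcases ValuationRing.isInteger_or_isInteger (S'.O x) (h : S'.K) with ⟨α, hα⟩ | ⟨α, hα⟩
  · exact hint α hα
  by_cases hαu : IsUnit α
  · obtain ⟨u, rfl⟩ := hαu
    refine hint (u⁻¹ : (S'.O x)ˣ) ?_
    have h1 : algebraMap (S'.O x) S'.K (u : S'.O x) * h = 1 := by
      rw [hα, inv_mul_cancel₀ h.ne_zero]
    have h2 : algebraMap (S'.O x) S'.K (u : S'.O x) *
        algebraMap (S'.O x) S'.K (u⁻¹ : (S'.O x)ˣ) = 1 := by
      rw [← map_mul, Units.mul_inv, map_one]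
    exact mul_left_cancel₀ ((map_ne_zero_iff _ hinj).mpr u.ne_zero) (h2.trans h1.symm)
  exfalso
  -- every generator of the foliation at the image point lifts to a field vanishing along the curve
  have hrel : ∀ {v₁ : S.RatVectorField}, F.T (p x) = Submodule.span (S.O (p x)) {v₁} →
      ∀ v' : Derivation ℂ (S.O (p x)) (S.O (p x)),
      (∀ a, algebraMap (S.O (p x)) S.K (v' a) = v₁ (algebraMap (S.O (p x)) S.K a)) →
      ∃ D : Derivation ℂ (S'.O x) (S'.O x), ∀ b,
        stalkAlgHom p hp x (v' b) = t * D (stalkAlgHom p hp x b) := by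
    intro v₁ hv₁ v' hv'
    have hmem : v₁ ∈ F.T (p x) := hv₁ ▸ Submodule.mem_span_singleton_self v₁
    rw [hv] at hmem
    obtain ⟨c, rfl⟩ := Submodule.mem_span_singleton.mp hmem
    obtain ⟨v₀, hv₀⟩ := SmoothProjectiveSurface.exists_derivation_of_mem_tangent
      (F.le_tangent _ (hv ▸ Submodule.mem_span_singleton_self v))
    obtain ⟨β, hβ⟩ : t ∣ α := by
      rwa [← Ideal.mem_span_singleton, ← ht.maximalIdeal_eq, mem_maximalIdeal]
    refine ⟨(stalkAlgHom p hp x c * β) • w', fun b => ?_⟩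
    have h1 : α * w' (stalkAlgHom p hp x b) = stalkAlgHom p hp x (v₀ b) := by
      apply hinj
      rw [map_mul, algebraMap_derivation_stalkAlgHom hp hwv hv₀ hw', hα,
        inv_mul_cancel_left₀ h.ne_zero]
    have h2 : v' b = c * v₀ b := by
      apply IsFractionRing.injective (S.O (p x)) S.K
      rw [hv', map_mul, hv₀, Foliation.smul_eq_algebraMap_smul]
      rfl
    rw [h2, map_mul, ← h1, hβ, Derivation.smul_apply, smul_eq_mul]
    ring
  have hnu : ∀ a : S.O (p x), ∀ b : S'.O x, stalkAlgHom p hp x a = t * b → ¬ IsUnit a := by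
    intro a b hab ha
    exact ht.not_isUnit (isUnit_of_mul_isUnit_left (hab ▸ ha.map (stalkAlgHom p hp x)))
  by_cases hsing : F.IsSingularPoint (p x)
  · obtain ⟨-, v₁, hv₁, z, hz, A, hA, l, m, hlm, hm, hr⟩ := hred _ hsing
    obtain ⟨v', hv'⟩ := SmoothProjectiveSurface.exists_derivation_of_mem_tangent
      (F.le_tangent _ (hv₁ ▸ Submodule.mem_span_singleton_self v₁))
    obtain ⟨D, hD⟩ := hrel hv₁ v' hv'
    refine Derivation.false_of_reduced (stalkAlgHom p hp x) hφ
      (exists_eval₂_stalkAlgHom_eq_zero hp x)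
      (exists_sub_algebraMap_mem_of_isContracted hp hc)
      (S'.isPrincipal_maximalIdeal_of_coheight hx).2 ht v' D hD z hz A (fun i => ?_) hlm hm hr
    obtain ⟨e, he, h1⟩ := hA i
    refine ⟨e, he, IsFractionRing.injective (S.O (p x)) S.K ?_⟩
    rw [hv', h1]
    rfl
  · obtain ⟨v', hv'⟩ := SmoothProjectiveSurface.exists_derivation_of_mem_tangent
      (F.le_tangent _ (hv ▸ Submodule.mem_span_singleton_self v))
    obtain ⟨D, hD⟩ := hrel hv v' hv'
    apply hsing
    intro v₁ hv₁ a
    rw [hv] at hv₁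
    obtain ⟨c, rfl⟩ := Submodule.mem_span_singleton.mp hv₁
    refine ⟨c * v' a, Ideal.mul_mem_left _ _ ((mem_maximalIdeal _).mpr (hnu _ _ (hD a))), ?_⟩
    rw [map_mul, hv', Foliation.smul_eq_algebraMap_smul]
    rfl

end Discrepancy

/-! ### The discrepancy divisor -/

section WeilDivisor

variable {X : Scheme.{0}}

lemma WeilDivisor.add_apply (D E : WeilDivisor X) (x : X) :
    ((D + E : WeilDivisor X) : AlgebraicCycle X ℤ) x =
      (D : AlgebraicCycle X ℤ) x + (E : AlgebraicCycle X ℤ) x :=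
  rfl

lemma WeilDivisor.sub_apply (D E : WeilDivisor X) (x : X) :
    ((D - E : WeilDivisor X) : AlgebraicCycle X ℤ) x =
      (D : AlgebraicCycle X ℤ) x - (E : AlgebraicCycle X ℤ) x := by
  rw [AddSubgroup.coe_sub]
  rfl

lemma WeilDivisor.ext_apply {D E : WeilDivisor X}
    (h : ∀ x, (D : AlgebraicCycle X ℤ) x = (E : AlgebraicCycle X ℤ) x) : D = E :=
  Subtype.ext (DFunLike.ext _ _ h)

open Classical in
/-- The part of a Weil divisor supported on the prime divisors that satisfy `P`. -/
def WeilDivisor.filter (D : WeilDivisor X) (P : X → Prop) : WeilDivisor X :=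
  ⟨{ toFun := fun x => if P x then (D : AlgebraicCycle X ℤ) x else 0
     supportWithinDomain' := Set.subset_univ _
     supportLocallyFiniteWithinDomain' := by
      intro x hx
      obtain ⟨V, hV, hfin⟩ := (D : AlgebraicCycle X ℤ).supportLocallyFiniteWithinDomain' x hx
      refine ⟨V, hV, hfin.subset fun y hy => ⟨hy.1, fun h => hy.2 ?_⟩⟩
      change (if P y then (D : AlgebraicCycle X ℤ) y else 0) = 0
      rw [show (D : AlgebraicCycle X ℤ) y = 0 from h, ite_self] },
    fun x hx => D.2 x fun h => hx (by
      change (if P x then (D : AlgebraicCycle X ℤ) x else 0) = 0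
      rw [h, ite_self])⟩

lemma WeilDivisor.filter_apply_of_pos (D : WeilDivisor X) {P : X → Prop} {x : X} (h : P x) :
    (WeilDivisor.filter D P : AlgebraicCycle X ℤ) x = (D : AlgebraicCycle X ℤ) x :=
  if_pos h

lemma WeilDivisor.filter_apply_of_neg (D : WeilDivisor X) {P : X → Prop} {x : X} (h : ¬ P x) :
    (WeilDivisor.filter D P : AlgebraicCycle X ℤ) x = 0 :=
  if_neg h

variable [IsIntegral X] [IsLocallyNoetherian X]

lemma CartierDivisor.toWeil_apply {D : CartierDivisor X} {x : X} {f : (X.functionField)ˣ}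
    (h : D.germ x = QuotientGroup.mk f) :
    (D.toWeil : AlgebraicCycle X ℤ) x = Scheme.ord (f : X.functionField) x :=
  D.mult_eq x f h

end WeilDivisor

section Global

variable {S S' : SmoothProjectiveSurface} {p : S'.X ⟶ S.X} {F : Foliation S} {F' : Foliation S'}

/-- The foliation has rank one: all vector fields defining it are proportional. -/
lemma Foliation.IsCanonicalDivisor.exists_field {D : CartierDivisor S.X}
    (hD : F.IsCanonicalDivisor D) :
    ∃ v : S.RatVectorField, v ≠ 0 ∧ (∀ y, ∀ v' ∈ F.T y, ∃ c : S.K, v' = c • v) ∧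
      ∀ (x : S.X) (f : (S.K)ˣ), D.germ x = QuotientGroup.mk f →
        F.T x = Submodule.span (S.O x) {(f : S.K) • v} := by
  obtain ⟨v, hv⟩ := hD
  refine ⟨v, ?_, fun y v' hv' => ?_, hv⟩
  · rintro rfl
    obtain ⟨f, hf⟩ := QuotientGroup.mk_surjective (D.germ (genericPoint S.X))
    exact F.generator_ne_zero (hv _ f hf.symm) (smul_zero _)
  · obtain ⟨f, hf⟩ := QuotientGroup.mk_surjective (D.germ y)
    rw [hv y f hf.symm] at hv'
    obtain ⟨a, rfl⟩ := Submodule.mem_span_singleton.mp hv'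
    exact ⟨algebraMap _ _ a * f, by rw [smul_eq_algebraMap_smul, mul_smul]⟩

variable [IsGenericallyFinite p]

/-- The factor relating the vector fields is not zero, since a derivation of an algebraic extension
is determined by its values on the smaller field. -/
lemma Foliation.IsPullback.exists_units_relation (hF : F.IsPullback p F')
    {v : S.RatVectorField} (hv0 : v ≠ 0) (hv : ∀ y, ∀ v' ∈ F.T y, ∃ c : S.K, v' = c • v)
    {x : S'.X} {w : S'.RatVectorField} (hw0 : w ≠ 0) (hw : w ∈ F'.T x) :
    ∃ h : (S'.K)ˣ, ∀ b, w (functionFieldMap p b) = h * functionFieldMap p (v b) := by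
  obtain ⟨h, hh⟩ := hF.exists_relation hv0 hv hw
  have hne : h ≠ 0 := by
    rintro rfl
    exact hw0 (Derivation.eq_zero_of_functionFieldMap p w fun b => by rw [hh, zero_mul])
  exact ⟨Units.mk0 h hne, hh⟩

/-- The difference of a canonical divisor and the pull-back of one is linearly equivalent to the
divisor of the discrepancies, i.e. of the factors by which local generators of the two foliations
differ. These depend on the generators only up to units. -/
theorem exists_toWeil_sub_apply_eq_ord (hF : F.IsPullback p F')
    {D : CartierDivisor S.X} {D' : CartierDivisor S'.X} (hD : F.IsCanonicalDivisor D)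
    (hD' : F'.IsCanonicalDivisor D') :
    ∃ g : (S'.K)ˣ, ∀ (x : S'.X) (v : S.RatVectorField) (w : S'.RatVectorField),
      F.T (p x) = Submodule.span (S.O (p x)) {v} → F'.T x = Submodule.span (S'.O x) {w} →
      ∃ h : (S'.K)ˣ, (∀ b, w (functionFieldMap p b) = h * functionFieldMap p (v b)) ∧
        ((D'.toWeil - (D.pullback p).toWeil - (CartierDivisor.principal S'.X g).toWeil :
          WeilDivisor S'.X) : AlgebraicCycle S'.X ℤ) x =
          Scheme.ord (h : S'.X.functionField) x := by
  obtain ⟨v₀, hv0, hvm, hv⟩ := hD.exists_field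
  obtain ⟨w₀, hw0, -, hw⟩ := hD'.exists_field
  have hmem : ∀ (x : S'.X) (f : (S'.K)ˣ), D'.germ x = QuotientGroup.mk f →
      (f : S'.K) • w₀ ∈ F'.T x := fun x f hf => by
    rw [hw x f hf]
    exact Submodule.mem_span_singleton_self _
  obtain ⟨f₁, hf₁⟩ := QuotientGroup.mk_surjective (D'.germ (genericPoint S'.X))
  obtain ⟨g₁, hg₁⟩ := hF.exists_units_relation hv0 hvm (smul_ne_zero f₁.ne_zero hw0)
    (hmem _ f₁ hf₁.symm)
  have hg : ∀ b, w₀ (functionFieldMap p b) =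
      ((f₁⁻¹ * g₁ : (S'.K)ˣ) : S'.K) * functionFieldMap p (v₀ b) := by
    intro b
    rw [Units.val_mul, mul_assoc, ← hg₁, Derivation.smul_apply, smul_eq_mul,
      Units.inv_mul_cancel_left]
  generalize f₁⁻¹ * g₁ = g at hg
  refine ⟨g⁻¹, fun x v w hvx hwx => ?_⟩
  obtain ⟨f, hf⟩ := QuotientGroup.mk_surjective (D.germ (p x))
  obtain ⟨f', hf'⟩ := QuotientGroup.mk_surjective (D'.germ x)
  obtain ⟨a, ha, rfl⟩ := Foliation.exists_unit_of_span_eq (p x) (F.generator_ne_zero hvx)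
    (hvx.symm.trans (hv _ f hf.symm))
  obtain ⟨b, hb, rfl⟩ := Foliation.exists_unit_of_span_eq x (F'.generator_ne_zero hwx)
    (hwx.symm.trans (hw _ f' hf'.symm))
  let φ : (S.K)ˣ →* (S'.K)ˣ := Units.map (functionFieldMap p).toMonoidHom
  have hφa : φ a ∈ localUnits S'.X x := by
    obtain ⟨u, rfl⟩ := ha
    exact ⟨Units.map (p.stalkMap x).hom.toMonoidHom u,
      Units.ext (functionFieldMap_algebraMap p x u).symm⟩
  refine ⟨b * f' * g * (φ a * φ f)⁻¹, fun c => ?_, ?_⟩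
  · have h1 : functionFieldMap p (((a : S.K) • (f : S.K) • v₀) c) =
        ((φ a * φ f : (S'.K)ˣ) : S'.K) * functionFieldMap p (v₀ c) := by
      rw [Derivation.smul_apply, Derivation.smul_apply, smul_eq_mul, smul_eq_mul, map_mul, map_mul,
        Units.val_mul, mul_assoc]
      rfl
    rw [h1, Units.val_mul _ (φ a * φ f)⁻¹, mul_assoc, Units.inv_mul_cancel_left,
      Derivation.smul_apply, Derivation.smul_apply, smul_eq_mul, smul_eq_mul, hg, Units.val_mul,
      Units.val_mul]
    ring
  · have hpull : (D.pullback p).germ x = QuotientGroup.mk (φ f) := by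
      change QuotientGroup.map _ _ _ _ (D.germ (p x)) = _
      rw [← hf]
      rfl
    rw [WeilDivisor.sub_apply, WeilDivisor.sub_apply, CartierDivisor.toWeil_apply hf'.symm,
      CartierDivisor.toWeil_apply hpull,
      CartierDivisor.toWeil_apply (D := CartierDivisor.principal S'.X g⁻¹) (f := g⁻¹) rfl,
      ord_units_mul, ord_units_mul, ord_units_mul, ord_units_inv, ord_units_inv, ord_units_mul,
      ord_eq_zero_of_mem_localUnits hφa, ord_eq_zero_of_mem_localUnits hb]
    ring

end Global

theorem theoremA1 (S S' : SmoothProjectiveSurface) (p : S'.X ⟶ S.X) [IsGenericallyFinite p]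
    (hp : p ≫ S.str = S'.str) (F : Foliation S) (F' : Foliation S') (hF : F.IsPullback p F') :
    ∃ R E : WeilDivisor S'.X,
      (∀ x, (R : AlgebraicCycle S'.X ℤ) x = F'.ramificationMult p x) ∧
      (∀ x, (E : AlgebraicCycle S'.X ℤ) x ≠ 0 → IsContracted p x) ∧
      (∀ (D : CartierDivisor S.X) (D' : CartierDivisor S'.X),
        F.IsCanonicalDivisor D → F'.IsCanonicalDivisor D' →
          WeilDivisor.LinEquiv D'.toWeil ((D.pullback p).toWeil + R + E)) ∧
      (F.IsReduced → ∀ x, 0 ≤ (E : AlgebraicCycle S'.X ℤ) x) := by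
  choose v hv using fun x => (F.exists_generator x).imp fun _ h => h.2
  choose w hw using fun x => (F'.exists_generator x).imp fun _ h => h.2
  obtain ⟨D₀, hD₀⟩ := F.exists_isCanonicalDivisor
  obtain ⟨D₀', hD₀'⟩ := F'.exists_isCanonicalDivisor
  obtain ⟨g₀, hg₀⟩ := exists_toWeil_sub_apply_eq_ord hF hD₀ hD₀'
  generalize hT : D₀'.toWeil - (D₀.pullback p).toWeil -
    (CartierDivisor.principal S'.X g₀).toWeil = T at hg₀
  choose h hwv hTh using fun x => hg₀ x (v (p x)) (w x) (hv (p x)) (hw x)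
  refine ⟨WeilDivisor.filter T fun x => ¬ IsContracted p x, WeilDivisor.filter T (IsContracted p),
    fun x => ?_, fun x hx => ?_, fun D D' hD hD' => ?_, fun hred x => ?_⟩
  · by_cases hc : IsContracted p x
    · rw [WeilDivisor.filter_apply_of_neg T (not_not.mpr hc), Foliation.ramificationMult,
        if_neg (by tauto)]
    · rw [WeilDivisor.filter_apply_of_pos (P := fun x => ¬ IsContracted p x) T hc]
      by_cases hx : Order.coheight x = 1
      · rw [hTh]
        exact ord_eq_ramificationMult hp hF hx hc (hv _) (hw _) (h x) (hwv x)
      · rw [Foliation.ramificationMult, if_neg (by tauto)]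
        by_contra h0
        exact hx (T.2 x h0)
  · by_contra hc
    exact hx (WeilDivisor.filter_apply_of_neg T hc)
  · -- the divisor `T` of the discrepancies is the same for all canonical divisors
    obtain ⟨g, hg⟩ := exists_toWeil_sub_apply_eq_ord hF hD hD'
    refine ⟨g, ?_⟩
    suffices hDT : D'.toWeil - (D.pullback p).toWeil - (CartierDivisor.principal S'.X g).toWeil =
        (WeilDivisor.filter T fun x => ¬ IsContracted p x) +
          WeilDivisor.filter T (IsContracted p) by
      rw [add_assoc, ← hDT]
      abel
    refine WeilDivisor.ext_apply fun x => ?_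
    obtain ⟨h', hwv', hh'⟩ := hg x (v (p x)) (w x) (hv (p x)) (hw x)
    have hsplit : ((WeilDivisor.filter T (fun x => ¬ IsContracted p x) +
        WeilDivisor.filter T (IsContracted p) :
        WeilDivisor S'.X) : AlgebraicCycle S'.X ℤ) x = (T : AlgebraicCycle S'.X ℤ) x := by
      rw [WeilDivisor.add_apply]
      by_cases hc : IsContracted p x
      · rw [WeilDivisor.filter_apply_of_neg T (not_not.mpr hc),
          WeilDivisor.filter_apply_of_pos T hc, zero_add]
      · rw [WeilDivisor.filter_apply_of_pos (P := fun x => ¬ IsContracted p x) T hc,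
          WeilDivisor.filter_apply_of_neg T hc, add_zero]
    rw [hsplit, hh', hTh]
    -- the factor relating two given vector fields is unique
    obtain ⟨b, hb⟩ : ∃ b, v (p x) b ≠ 0 := by
      by_contra! hcon
      exact F.generator_ne_zero (hv (p x)) (Derivation.ext hcon)
    rw [mul_right_cancel₀ ((map_ne_zero (functionFieldMap p)).mpr hb)
      ((hwv' b).symm.trans (hwv x b))]
  · by_cases hc : IsContracted p x
    · rw [WeilDivisor.filter_apply_of_pos T hc]
      by_cases hx : Order.coheight x = 1
      · rw [hTh]
        exact ord_nonneg_of_isReduced hp hred hx hc (hv _) (hw _) (h x) (hwv x)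
      · exact le_of_eq (by_contra fun h0 => hx (T.2 x (Ne.symm h0)))
    · rw [WeilDivisor.filter_apply_of_neg T hc]

end
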